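/- Units: $\hbar=1$. A system (position and momentum $Q,P$) is coupled to two probes ($Q_1,P_1$ and $Q_2,P_2$) by $U=e^{-iH}$ with $H=\lambda QP_1-\mu PQ_2+\tfrac{\lambda\mu}{2}\kappa P_1Q_2$, where $\lambda,\mu>0$ and $\kappa\in\mathbb R$. The system starts in a pure state $\psi\in L^2(\mathbb R)$ with finite position and momentum variance, and the probes start in a state $\sigma$. After the coupling the position of probe 1 and the momentum of probe 2 are measured. Let $\mathsf E^{(\lambda,\mu)}$ be the distribution of the first reading divided by $\lambda$, and $\mathsf F^{(\lambda,\mu)}$ the distribution of the second reading divided by $\mu$. Let $\mathsf E^{(\lambda,0)}$ and $\mathsf F^{(0,\mu)}$ be the same distributions when the coupling is replaced by the one with $\mu=0$, respectively $\lambda=0$. Put $$\mathcal F(Q)=\operatorname{Var}\mathsf E^{(\lambda,\mu)}-\operatorname{Var}\mathsf E^{(\lambda,0)},\qquad \mathcal F(P)=\operatorname{Var}\mathsf F^{(\lambda,\mu)}-\operatorname{Var}\mathsf F^{(0,\mu)}.$$ Joint focusing means that $\mathcal F(Q)<0$ and $\mathcal F(P)<0$. In all cases below the distributions are probability measures with finite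 second moments, and the statements hold for every such $\psi$. (1) Let $D=\begin{pmatrix}a&b\\ b&d\end{pmatrix}$ be a real positive definite matrix and let $\sigma$ be the pure state $\varphi_{12}(q_1,q_2)=\left(\tfrac{4\det D}{\pi^2}\right)^{1/4}\exp\left[-(q_1,q_2)D(q_1,q_2)^T\right]$. Then joint focusing holds if and only if $$|\kappa|>1,\qquad \kappa b>0\qquad\text{and}\qquad \tfrac{\lambda\mu}{4}(1+|\kappa|)<\tfrac{|b|}{a}.$$ Consequently, joint focusing can be achieved with one of the two sign choices $\pm b$ of the off-diagonal entry if and only if $|\kappa|>1$ and $\tfrac{\lambda\mu}{4}(1+|\kappa|)<\tfrac{|b|}{a}$. (2) Let $0<p<1$ and let $\sigma=p\sigma_1+(1-p)\sigma_2$, where each $\sigma_i$ is a pure product of two single-mode Gaussian states, one for each probe, both with mean position $x_i$, mean momentum $k_i$, position variance $S$ and momentum variance $R$ (the same $S,R$ for $i=1,2$). Then $$\operatorname{Cov}(Q_1,Q_2,\sigma)=(p-p^2)(x_1-x_2)^2,\qquad \operatorname{Cov}(P_1,P_2,\sigma)=(p-p^2)(k_1-k_2)^2,$$ and joint focusing implies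 $|\kappa|<1$. Conversely, suppose that $|\kappa|<1$ and $\tfrac{\lambda\mu}{4}(1+|\kappa|)<1$. Then there is a constant $C$, depending only on $\lambda,\mu,\kappa,S,R$, such that joint focusing holds whenever both covariances are at least $C$. In particular there is a constant $L$, depending only on $\lambda,\mu,\kappa,S,R,p$, such that joint focusing holds whenever $|x_1-x_2|\ge L$ and $|k_1-k_2|\ge L$. -/

import Mathlib

open MeasureTheory ProbabilityTheory

namespace ArthursKelly

noncomputable section

/-! Units with `ℏ = 1`.  Configuration space of system and probes: a point `v : ℝ × ℝ × ℝ` is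
`(q, q₁, q₂)` with `q` the system coordinate, `q₁`, `q₂` the coordinates of probes 1 and 2. -/

/-- Directional momentum operator `-i ∂_e` on wave functions of the three particles. -/
def momentumOp (e : ℝ × ℝ × ℝ) (f : ℝ × ℝ × ℝ → ℂ) : ℝ × ℝ × ℝ → ℂ :=
  fun v => -Complex.I * fderiv ℝ f v e

/-- Position operator `Q` of the system. -/
def posSys (f : ℝ × ℝ × ℝ → ℂ) : ℝ × ℝ × ℝ → ℂ := fun v => (v.1 : ℂ) * f v

/-- Position operator `Q₂` of the second probe. -/
def posTwo (f : ℝ × ℝ × ℝ → ℂ) : ℝ × ℝ × ℝ → ℂ := fun v => (v.2.2 : ℂ) * f v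

/-- Momentum operator `P` of the system. -/
def momSys : (ℝ × ℝ × ℝ → ℂ) → (ℝ × ℝ × ℝ → ℂ) := momentumOp (1, 0, 0)

/-- Momentum operator `P₁` of the first probe. -/
def momOne : (ℝ × ℝ × ℝ → ℂ) → (ℝ × ℝ × ℝ → ℂ) := momentumOp (0, 1, 0)

/-- The coupling Hamiltonian `H = λ Q P₁ - μ P Q₂ + (λ μ / 2) κ P₁ Q₂`. -/
def hamiltonian (lam mu kap : ℝ) (f : ℝ × ℝ × ℝ → ℂ) : ℝ × ℝ × ℝ → ℂ :=
  fun v => (lam : ℂ) * posSys (momOne f) v - (mu : ℂ) * momSys (posTwo f) v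
    + ((lam * mu / 2 * kap : ℝ) : ℂ) * momOne (posTwo f) v

/-- The unitary group `exp(-i t H)` in the position representation.  As `-i H` is a linear vector
field, it acts by composition with the flow of this field; `evolve_zero`, `evolve_add` and
`evolve_schrodinger` below show that this is the group with generator `-i H`. -/
def evolve (lam mu kap t : ℝ) (f : ℝ × ℝ × ℝ → ℂ) : ℝ × ℝ × ℝ → ℂ :=
  fun v => f (v.1 + t * mu * v.2.2,
    v.2.1 - t * lam * v.1 - lam * mu / 2 * (t * kap + t ^ 2) * v.2.2, v.2.2)

theorem evolve_zero (lam mu kap : ℝ) (f : ℝ × ℝ × ℝ → ℂ) : evolve lam mu kap 0 f = f := by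
  funext v
  simp [evolve]

theorem evolve_add (lam mu kap s t : ℝ) (f : ℝ × ℝ × ℝ → ℂ) :
    evolve lam mu kap (s + t) f = evolve lam mu kap s (evolve lam mu kap t f) := by
  funext v
  simp only [evolve]
  congr 1
  ext <;> simp only <;> ring

/-- `Ψ_t = evolve t f` solves the Schrödinger equation `dΨ_t/dt = -i H Ψ_t`. -/
theorem evolve_schrodinger (lam mu kap : ℝ) (f : ℝ × ℝ × ℝ → ℂ) (hf : Differentiable ℝ f)
    (t : ℝ) (v : ℝ × ℝ × ℝ) :
    HasDerivAt (fun s => evolve lam mu kap s f v)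
      (-Complex.I * hamiltonian lam mu kap (evolve lam mu kap t f) v) t := by
  have hg : Differentiable ℝ (evolve lam mu kap t f) := by
    unfold evolve
    fun_prop
  have key : ∀ e : ℝ × ℝ × ℝ, fderiv ℝ (evolve lam mu kap t f) v e =
      fderiv ℝ f (v.1 + t * mu * v.2.2,
        v.2.1 - t * lam * v.1 - lam * mu / 2 * (t * kap + t ^ 2) * v.2.2, v.2.2)
        (e.1 + t * mu * e.2.2,
          e.2.1 - t * lam * e.1 - lam * mu / 2 * (t * kap + t ^ 2) * e.2.2, e.2.2) := by
    intro e
    have h1 : HasDerivAt (fun s : ℝ => evolve lam mu kap t f (v + s • e))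
        (fderiv ℝ (evolve lam mu kap t f) v e) 0 := by
      have := (hg v).hasFDerivAt.hasLineDerivAt e
      simpa [HasLineDerivAt] using this
    have h2 : HasDerivAt (fun s : ℝ => (((v + s • e).1 + t * mu * (v + s • e).2.2,
        (v + s • e).2.1 - t * lam * (v + s • e).1
          - lam * mu / 2 * (t * kap + t ^ 2) * (v + s • e).2.2, (v + s • e).2.2) : ℝ × ℝ × ℝ))
        (e.1 + t * mu * e.2.2,
          e.2.1 - t * lam * e.1 - lam * mu / 2 * (t * kap + t ^ 2) * e.2.2, e.2.2) 0 := by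
      have c : ∀ x y : ℝ, HasDerivAt (fun s : ℝ => x + s * y) y 0 := fun x y => by
        simpa using ((hasDerivAt_id (0 : ℝ)).mul_const y).const_add x
      simp only [Prod.fst_add, Prod.snd_add, Prod.smul_fst, Prod.smul_snd, smul_eq_mul]
      exact ((c _ _).add ((c _ _).const_mul _)).prodMk
        ((((c _ _).sub ((c _ _).const_mul _)).sub ((c _ _).const_mul _)).prodMk (c _ _))
    have h3 := (hf _).hasFDerivAt.comp_hasDerivAt (0 : ℝ) h2
    have h4 := h1.unique h3
    simpa using h4
  have hmul : ∀ e : ℝ × ℝ × ℝ, e.2.2 = 0 →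
      fderiv ℝ (posTwo (evolve lam mu kap t f)) v e =
        (v.2.2 : ℂ) * fderiv ℝ (evolve lam mu kap t f) v e := by
    intro e he
    have h1 : HasFDerivAt (fun u : ℝ × ℝ × ℝ => (u.2.2 : ℂ))
        (Complex.ofRealCLM ∘L (ContinuousLinearMap.snd ℝ ℝ ℝ ∘L
          ContinuousLinearMap.snd ℝ ℝ (ℝ × ℝ))) v :=
      ContinuousLinearMap.hasFDerivAt (Complex.ofRealCLM ∘L (ContinuousLinearMap.snd ℝ ℝ ℝ ∘L
          ContinuousLinearMap.snd ℝ ℝ (ℝ × ℝ)))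
    have h2 := (h1.mul (hg v).hasFDerivAt).fderiv
    have h3 : posTwo (evolve lam mu kap t f) =
        (fun u : ℝ × ℝ × ℝ => (u.2.2 : ℂ)) * evolve lam mu kap t f := rfl
    rw [h3, h2]
    simp [he]
  have h2 : HasDerivAt (fun s : ℝ => ((v.1 + s * mu * v.2.2,
      v.2.1 - s * lam * v.1 - lam * mu / 2 * (s * kap + s ^ 2) * v.2.2, v.2.2) : ℝ × ℝ × ℝ))
      (mu * v.2.2, -(lam * v.1) - lam * mu / 2 * (kap + 2 * t) * v.2.2, 0) t := by
    refine HasDerivAt.prodMk ?_ (HasDerivAt.prodMk ?_ (hasDerivAt_const _ _))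
    · simpa using (((hasDerivAt_id t).mul_const mu).mul_const v.2.2).const_add v.1
    · have e1 := (((hasDerivAt_id t).mul_const lam).mul_const v.1).const_sub v.2.1
      have e2 := ((((hasDerivAt_id t).mul_const kap).add ((hasDerivAt_id t).pow 2)).const_mul
        (lam * mu / 2)).mul_const v.2.2
      refine (e1.sub e2).congr_deriv ?_
      simp
  have h3 := (hf _).hasFDerivAt.comp_hasDerivAt t h2
  refine h3.congr_deriv ?_
  simp only [hamiltonian, posSys, momOne, momSys, momentumOp]
  rw [hmul _ rfl, hmul _ rfl, key, key]
  set w : ℝ × ℝ × ℝ := (v.1 + t * mu * v.2.2,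
    v.2.1 - t * lam * v.1 - lam * mu / 2 * (t * kap + t ^ 2) * v.2.2, v.2.2)
  have d1 : ((mu * v.2.2, -(lam * v.1) - lam * mu / 2 * (kap + 2 * t) * v.2.2, 0) : ℝ × ℝ × ℝ)
      = (mu * v.2.2) • ((1, -(t * lam), 0) : ℝ × ℝ × ℝ)
        + (-(lam * v.1) - lam * mu / 2 * kap * v.2.2) • ((0, 1, 0) : ℝ × ℝ × ℝ) := by
    ext <;> simp
    ring
  have hI : Complex.I * Complex.I = -1 := Complex.I_mul_I
  rw [d1, map_add, map_smul, map_smul]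
  simp only [mul_zero, add_zero, mul_one, zero_sub, sub_zero, Complex.real_smul]
  push_cast
  linear_combination ((mu : ℂ) * v.2.2 * fderiv ℝ f w (1, -(t * lam), 0)
    - ((lam : ℂ) * v.1 + lam * mu / 2 * kap * v.2.2) * fderiv ℝ f w (0, 1, 0)) * hI

/-- The state of system and probes after the coupling `U = exp(-i H)`, for a system in the pure
state `ψ` and probes in the pure state `φ`. -/
def coupled (lam mu kap : ℝ) (φ : ℝ × ℝ → ℂ) (ψ : ℝ → ℂ) : ℝ × ℝ × ℝ → ℂ :=
  evolve lam mu kap 1 (fun v => ψ v.1 * φ v.2)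

/-- Unitary Fourier transform in one variable. -/
def fourierOne (f : ℝ → ℂ) (p : ℝ) : ℂ :=
  ((Real.sqrt (2 * Real.pi))⁻¹ : ℝ) * ∫ q : ℝ, Complex.exp (-Complex.I * (p * q : ℝ)) * f q

/-- Unitary Fourier transform in two variables. -/
def fourierTwo (φ : ℝ × ℝ → ℂ) (p : ℝ × ℝ) : ℂ :=
  ((2 * Real.pi)⁻¹ : ℝ) *
    ∫ q : ℝ × ℝ, Complex.exp (-Complex.I * (p.1 * q.1 + p.2 * q.2 : ℝ)) * φ q

/-- The coupled state in the representation `(q, q₁, p₂)`: position for the system and probe 1,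
momentum for probe 2. -/
def coupledMixed (lam mu kap : ℝ) (φ : ℝ × ℝ → ℂ) (ψ : ℝ → ℂ) : ℝ × ℝ × ℝ → ℂ :=
  fun v => fourierOne (fun q₂ => coupled lam mu kap φ ψ (v.1, v.2.1, q₂)) v.2.2

/-- Joint law of the pointer readings (position of probe 1, momentum of probe 2) after the coupling,
with pure probe state `φ`: `X × Y ↦ ⟨Ψ | I ⊗ E^{Q₁}(X) ⊗ E^{P₂}(Y) Ψ⟩`. -/
def purePointerLaw (lam mu kap : ℝ) (φ : ℝ × ℝ → ℂ) (ψ : ℝ → ℂ) : Measure (ℝ × ℝ) :=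
  ((volume : Measure (ℝ × ℝ × ℝ)).withDensity
    (fun v => ‖coupledMixed lam mu kap φ ψ v‖ₑ ^ 2)).map Prod.snd

/-- A preparation of the two probes, `σ = ∑ i, weight i • |wave i⟩⟨wave i|`. -/
structure ProbeEnsemble where
  size : ℕ
  weight : Fin size → ℝ
  wave : Fin size → ℝ × ℝ → ℂ

/-- The pure preparation `|φ⟩⟨φ|`. -/
def ProbeEnsemble.pure (φ : ℝ × ℝ → ℂ) : ProbeEnsemble := ⟨1, ![1], ![φ]⟩

/-- The mixture `p |φ₁⟩⟨φ₁| + (1 - p) |φ₂⟩⟨φ₂|`. -/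
def ProbeEnsemble.mix (p : ℝ) (φ₁ φ₂ : ℝ × ℝ → ℂ) : ProbeEnsemble :=
  ⟨2, ![p, 1 - p], ![φ₁, φ₂]⟩

/-- Joint law of the pointer readings for probes prepared in `σ`. -/
def pointerLaw (lam mu kap : ℝ) (σ : ProbeEnsemble) (ψ : ℝ → ℂ) : Measure (ℝ × ℝ) :=
  ∑ i, ENNReal.ofReal (σ.weight i) • purePointerLaw lam mu kap (σ.wave i) ψ

/-- Outcome distribution, in the system state `ψ`, of the position marginal, where the pointer
reading is rescaled by the coupling constant: `X ↦ ⟨ψ | E^{(λ,μ)}(X) ψ⟩`. -/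
def lawE (lam mu kap : ℝ) (σ : ProbeEnsemble) (ψ : ℝ → ℂ) : Measure ℝ :=
  (pointerLaw lam mu kap σ ψ).map (fun z => z.1 / lam)

/-- Outcome distribution, in the system state `ψ`, of the momentum marginal:
`Y ↦ ⟨ψ | F^{(λ,μ)}(Y) ψ⟩`. -/
def lawF (lam mu kap : ℝ) (σ : ProbeEnsemble) (ψ : ℝ → ℂ) : Measure ℝ :=
  (pointerLaw lam mu kap σ ψ).map (fun z => z.2 / mu)

/-- `𝓕(Q) = Var(E^{(λ,μ)}, ψ) - Var(E^{(λ,0)}, ψ)`: imprecision of the position marginal of the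
joint measurement relative to the measurement by probe 1 alone (coupling with `μ = 0`). -/
def focusQ (lam mu kap : ℝ) (σ : ProbeEnsemble) (ψ : ℝ → ℂ) : ℝ :=
  Var[id; lawE lam mu kap σ ψ] - Var[id; lawE lam 0 kap σ ψ]

/-- `𝓕(P) = Var(F^{(λ,μ)}, ψ) - Var(F^{(0,μ)}, ψ)`: imprecision of the momentum marginal of the
joint measurement relative to the measurement by probe 2 alone (coupling with `λ = 0`). -/
def focusP (lam mu kap : ℝ) (σ : ProbeEnsemble) (ψ : ℝ → ℂ) : ℝ :=
  Var[id; lawF lam mu kap σ ψ] - Var[id; lawF 0 mu kap σ ψ]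

/-- Joint focusing: `𝓕(Q) < 0` and `𝓕(P) < 0`. -/
def JointFocusing (lam mu kap : ℝ) (σ : ProbeEnsemble) (ψ : ℝ → ℂ) : Prop :=
  focusQ lam mu kap σ ψ < 0 ∧ focusP lam mu kap σ ψ < 0

/-- A probability distribution on the line with finite second moment, so that its variance is
meaningful. -/
def HasVariance (m : Measure ℝ) : Prop := IsProbabilityMeasure m ∧ MemLp id 2 m

/-- The four variances that enter `𝓕(Q)` and `𝓕(P)` are those of probability distributions with
finite second moment. -/
def FocusDefined (lam mu kap : ℝ) (σ : ProbeEnsemble) (ψ : ℝ → ℂ) : Prop :=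
  HasVariance (lawE lam mu kap σ ψ) ∧ HasVariance (lawE lam 0 kap σ ψ) ∧
    HasVariance (lawF lam mu kap σ ψ) ∧ HasVariance (lawF 0 mu kap σ ψ)

/-- A pure system state (normalised vector of `L²(ℝ)`) with finite position and momentum variance.
The finite second position moment makes `ψ` integrable, so `fourierOne ψ` is its Fourier
transform. -/
structure IsSystemState (ψ : ℝ → ℂ) : Prop where
  memLp : MemLp ψ 2 volume
  norm_one : ∫ q, ‖ψ q‖ ^ 2 = 1
  pos_moment : Integrable (fun q => q ^ 2 * ‖ψ q‖ ^ 2) volume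
  mom_moment : Integrable (fun p => p ^ 2 * ‖fourierOne ψ p‖ ^ 2) volume

/-- Joint law of `(Q₁, Q₂)` in the probe state `σ`. -/
def positionLaw (σ : ProbeEnsemble) : Measure (ℝ × ℝ) :=
  ∑ i, ENNReal.ofReal (σ.weight i) •
    (volume : Measure (ℝ × ℝ)).withDensity (fun z => ‖σ.wave i z‖ₑ ^ 2)

/-- Joint law of `(P₁, P₂)` in the probe state `σ`. -/
def momentumLaw (σ : ProbeEnsemble) : Measure (ℝ × ℝ) :=
  ∑ i, ENNReal.ofReal (σ.weight i) •
    (volume : Measure (ℝ × ℝ)).withDensity (fun z => ‖fourierTwo (σ.wave i) z‖ₑ ^ 2)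

/-- `Cov(Q₁, Q₂, σ)`. -/
def covQ (σ : ProbeEnsemble) : ℝ := cov[Prod.fst, Prod.snd; positionLaw σ]

/-- `Cov(P₁, P₂, σ)`. -/
def covP (σ : ProbeEnsemble) : ℝ := cov[Prod.fst, Prod.snd; momentumLaw σ]

/-- The unbiased two-mode Gaussian wave function
`(4 det D / π²)^{1/4} exp(-(q₁, q₂) D (q₁, q₂)ᵀ)`. -/
def twoModeGaussian (D : Matrix (Fin 2) (Fin 2) ℝ) (z : ℝ × ℝ) : ℂ :=
  (((4 * D.det / Real.pi ^ 2) ^ (1 / 4 : ℝ) *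
    Real.exp (-(![z.1, z.2] ⬝ᵥ Matrix.mulVec D ![z.1, z.2])) : ℝ) : ℂ)

/-- A normalised pure single-mode Gaussian state: the exponential of a complex quadratic
polynomial. -/
def IsGaussianWave (f : ℝ → ℂ) : Prop :=
  (∃ A B C : ℂ, 0 < A.re ∧ ∀ q : ℝ, f q = Complex.exp (-A * (q : ℂ) ^ 2 + B * (q : ℂ) + C)) ∧
    ∫ q, ‖f q‖ ^ 2 = 1

/-- `φ` is a product of two single-mode Gaussian states, both centred on the phase space point
`(x, k)`, with position variances `S` and momentum variances `R`. -/
structure IsGaussianProduct (x k S R : ℝ) (φ : ℝ × ℝ → ℂ) : Prop where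
  product : ∃ f g : ℝ → ℂ, IsGaussianWave f ∧ IsGaussianWave g ∧ ∀ z, φ z = f z.1 * g z.2
  mean_Q₁ : ∫ z, z.1 ∂(positionLaw (.pure φ)) = x
  mean_Q₂ : ∫ z, z.2 ∂(positionLaw (.pure φ)) = x
  mean_P₁ : ∫ z, z.1 ∂(momentumLaw (.pure φ)) = k
  mean_P₂ : ∫ z, z.2 ∂(momentumLaw (.pure φ)) = k
  var_Q₁ : Var[Prod.fst; positionLaw (.pure φ)] = S
  var_Q₂ : Var[Prod.snd; positionLaw (.pure φ)] = S
  var_P₁ : Var[Prod.fst; momentumLaw (.pure φ)] = R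
  var_P₂ : Var[Prod.snd; momentumLaw (.pure φ)] = R

end

end ArthursKelly

/-!
In configuration space the coupling is a volume-preserving linear map; by Plancherel it acts on
momentum space through the inverse transpose. The readings, rescaled by the coupling constants, are
therefore distributed as `Q + (Q₁ + λμ/2 (κ - 1) Q₂) / λ` and `P + (P₂ - λμ/2 (κ + 1) P₁) / μ`, with
noise that is independent of the system. Each focus is thus a quadratic polynomial in `κ` whose
coefficients are one covariance and one variance of the probe state.

Completing the square writes the two-mode Gaussian as a product of single-mode states composed with
the shear `(q₁, q₂) ↦ (q₁ + r q₂, q₂)`, `r = b / a`, which creates the covariances `-r Var Q₂` and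
`r Var P₁`. Their signs are opposite, which forces `|κ| > 1`. In the mixture both covariances are
nonnegative, which forces `|κ| < 1`.
-/

namespace ArthursKelly

section Plancherel

open FourierTransform

variable {V : Type*} [NormedAddCommGroup V] [InnerProductSpace ℝ V] [FiniteDimensional ℝ V]
  [MeasurableSpace V] [BorelSpace V] {f : V → ℂ}

theorem continuous_fourier (hf : Integrable f) : Continuous (𝓕 f) :=
  VectorFourier.fourierIntegral_continuous Real.continuous_fourierChar
    (by exact continuous_inner) hf

theorem integral_fourier_mul_eq_flip {g : V → ℂ} (hf : Integrable f) (hg : Integrable g) :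
    ∫ x, 𝓕 f x * g x = ∫ x, f x * 𝓕 g x := by
  have h := VectorFourier.integral_fourierIntegral_smul_eq_flip (e := Real.fourierChar)
    (L := innerₗ V) (μ := volume) (ν := volume) Real.continuous_fourierChar
    (by exact continuous_inner) hf hg
  rwa [flip_innerₗ] at h

/- Both sides are locally integrable and define the same tempered distribution. -/
theorem fourier_toLp_ae_eq (h₁ : Integrable f) (h₂ : MemLp f 2) :
    (𝓕 (h₂.toLp f) : Lp ℂ 2 (volume : Measure V)) =ᵐ[volume] 𝓕 f := by
  refine ae_eq_of_integral_contDiff_smul_eq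
    ((Lp.memLp _).locallyIntegrable (by norm_num)) (continuous_fourier h₁).locallyIntegrable ?_
  intro g hg hc
  let G : SchwartzMap V ℂ := HasCompactSupport.toSchwartzMap (f := fun x => (g x : ℂ))
    (hc.comp_left (g := fun x : ℝ => (x : ℂ)) (by simp)) (Complex.ofRealCLM.contDiff.comp hg)
  have hG : ∀ x, G x = (g x : ℂ) := fun _ => rfl
  have hdistribution := congrArg (fun T => T G) (Lp.fourier_toTemperedDistribution_eq (h₂.toLp f))
  simp only [TemperedDistribution.fourier_apply, Lp.toTemperedDistribution_apply] at hdistribution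
  calc ∫ x, g x • (𝓕 (h₂.toLp f) : Lp ℂ 2 (volume : Measure V)) x
      = ∫ x, G x • (𝓕 (h₂.toLp f) : Lp ℂ 2 (volume : Measure V)) x := by simp [hG]
    _ = ∫ x, (𝓕 G) x • (h₂.toLp f) x := hdistribution.symm
    _ = ∫ x, f x * 𝓕 (⇑G) x := by
        refine integral_congr_ae ?_
        filter_upwards [h₂.coeFn_toLp] with x hx
        rw [hx, SchwartzMap.fourier_coe, smul_eq_mul, mul_comm]
    _ = ∫ x, 𝓕 f x * G x := (integral_fourier_mul_eq_flip h₁ G.integrable).symm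
    _ = ∫ x, g x • 𝓕 f x := by simp [hG, mul_comm]

theorem eLpNorm_two_sq_eq_lintegral {α E : Type*} [MeasurableSpace α] [NormedAddCommGroup E]
    (μ : Measure α) (g : α → E) : eLpNorm g 2 μ ^ 2 = ∫⁻ x, ‖g x‖ₑ ^ 2 ∂μ := by
  simpa using eLpNorm_nnreal_pow_eq_lintegral (f := g) (μ := μ) (p := 2) two_ne_zero

theorem lintegral_enorm_sq_fourier (h₁ : Integrable f) (h₂ : MemLp f 2) :
    ∫⁻ x, ‖𝓕 f x‖ₑ ^ 2 = ∫⁻ x, ‖f x‖ₑ ^ 2 := by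
  rw [← eLpNorm_two_sq_eq_lintegral, ← eLpNorm_two_sq_eq_lintegral,
    ← eLpNorm_congr_ae (fourier_toLp_ae_eq h₁ h₂), ← eLpNorm_congr_ae h₂.coeFn_toLp,
    ← Lp.enorm_def, ← Lp.enorm_def, enorm_eq_iff_norm_eq.2 (Lp.norm_fourier_eq _)]

theorem fourierOne_eq_fourier (f : ℝ → ℂ) (p : ℝ) :
    fourierOne f p = ((√(2 * Real.pi))⁻¹ : ℝ) * 𝓕 f (p / (2 * Real.pi)) := by
  rw [fourierOne, Real.fourier_real_eq_integral_exp_smul]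
  congr 2 with q
  rw [smul_eq_mul]
  congr 2
  push_cast
  have : (Real.pi : ℂ) ≠ 0 := by exact_mod_cast Real.pi_ne_zero
  field_simp

theorem continuous_fourierOne {f : ℝ → ℂ} (hf : Integrable f) : Continuous (fourierOne f) := by
  rw [funext (fourierOne_eq_fourier f)]
  exact continuous_const.mul ((continuous_fourier hf).comp (continuous_id.div_const _))

theorem lintegral_enorm_sq_fourierOne {f : ℝ → ℂ} (h₁ : Integrable f) (h₂ : MemLp f 2) :
    ∫⁻ p, ‖fourierOne f p‖ₑ ^ 2 = ∫⁻ x, ‖f x‖ₑ ^ 2 := by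
  have hπ : 0 < 2 * Real.pi := by positivity
  have hmeas : Measurable (𝓕 f) := (continuous_fourier h₁).measurable
  have hscale (p : ℝ) : ‖fourierOne f p‖ₑ ^ 2 =
      ENNReal.ofReal (2 * Real.pi)⁻¹ * ‖𝓕 f ((2 * Real.pi)⁻¹ * p)‖ₑ ^ 2 := by
    rw [fourierOne_eq_fourier, enorm_mul, mul_pow, div_eq_inv_mul, ← ofReal_norm,
      Complex.norm_real, Real.norm_of_nonneg (by positivity),
      ← ENNReal.ofReal_pow (by positivity), inv_pow, Real.sq_sqrt hπ.le]
  calc ∫⁻ p, ‖fourierOne f p‖ₑ ^ 2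
      = ENNReal.ofReal (2 * Real.pi)⁻¹ *
          ∫⁻ p, ‖𝓕 f p‖ₑ ^ 2 ∂(Measure.map ((2 * Real.pi)⁻¹ * ·) volume) := by
        simp_rw [hscale]
        rw [lintegral_const_mul' _ _ ENNReal.ofReal_ne_top,
          lintegral_map (hmeas.enorm.pow_const 2) (measurable_const_mul _)]
    _ = ∫⁻ p, ‖𝓕 f p‖ₑ ^ 2 := by
        rw [Real.map_volume_mul_left (by positivity), lintegral_smul_measure, smul_eq_mul,
          ← mul_assoc, ← ENNReal.ofReal_mul (by positivity), inv_inv, abs_of_pos hπ,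
          inv_mul_cancel₀ hπ.ne', ENNReal.ofReal_one, one_mul]
    _ = ∫⁻ x, ‖f x‖ₑ ^ 2 := lintegral_enorm_sq_fourier h₁ h₂

end Plancherel

section BornLaw

variable {α β : Type*} [MeasureSpace α] [MeasureSpace β]

/-- The Born rule: the law `|f|²` of the observable diagonal in the representation in which the
pure state is the wave function `f`. -/
noncomputable def bornLaw (f : α → ℂ) : Measure α := volume.withDensity fun a => ‖f a‖ₑ ^ 2

theorem map_bornLaw_comp {f : β → ℂ} (hf : AEStronglyMeasurable f) {T : α → β}
    (hT : MeasurePreserving T) : (bornLaw (f ∘ T)).map T = bornLaw f := by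
  refine Measure.ext fun s hs => ?_
  rw [Measure.map_apply hT.measurable hs, bornLaw, bornLaw,
    withDensity_apply _ (hT.measurable hs), withDensity_apply _ hs]
  have hf' : AEMeasurable (fun b => ‖f b‖ₑ ^ 2) (volume.restrict s) :=
    (hf.enorm.pow_const 2).restrict
  rw [← (hT.restrict_preimage hs).map_eq] at hf' ⊢
  exact (lintegral_map' hf' (hT.restrict_preimage hs).aemeasurable).symm

instance [SFinite (volume : Measure α)] (f : α → ℂ) : SFinite (bornLaw f) := by
  unfold bornLaw
  infer_instance

theorem bornLaw_mul [SFinite (volume : Measure β)] {f : α → ℂ} {g : β → ℂ}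
    (hf : AEStronglyMeasurable f) (hg : AEStronglyMeasurable g) :
    bornLaw (fun z : α × β => f z.1 * g z.2) = (bornLaw f).prod (bornLaw g) := by
  rw [bornLaw, bornLaw, bornLaw, prod_withDensity₀ (hf.enorm.pow_const 2) (hg.enorm.pow_const 2)]
  simp only [enorm_mul, mul_pow]
  rfl

variable [SFinite (volume : Measure α)] [SFinite (volume : Measure β)]

theorem map_fst_bornLaw {F : α × β → ℂ} (hF : AEStronglyMeasurable F) :
    (bornLaw F).map Prod.fst = volume.withDensity fun a => ∫⁻ b, ‖F (a, b)‖ₑ ^ 2 := by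
  refine Measure.ext fun s hs => ?_
  rw [Measure.map_apply measurable_fst hs, bornLaw, withDensity_apply _ (measurable_fst hs),
    withDensity_apply _ hs, ← Set.prod_univ, Measure.volume_eq_prod, ← Measure.prod_restrict,
    Measure.restrict_univ, lintegral_prod]
  rw [← Measure.restrict_univ (μ := (volume : Measure β)), Measure.prod_restrict]
  exact (hF.enorm.pow_const 2).restrict

theorem map_snd_bornLaw {F : α × β → ℂ} (hF : AEStronglyMeasurable F) :
    (bornLaw F).map Prod.snd = volume.withDensity fun b => ∫⁻ a, ‖F (a, b)‖ₑ ^ 2 := by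
  have hswap : AEStronglyMeasurable (F ∘ Prod.swap) :=
    hF.comp_measurePreserving Measure.measurePreserving_swap
  rw [← map_bornLaw_comp hF Measure.measurePreserving_swap,
    Measure.map_map measurable_snd measurable_swap]
  exact map_fst_bornLaw hswap

end BornLaw

section Phase

variable {α : Type*}

theorem norm_exp_neg_I_mul_ofReal (x : ℝ) : ‖Complex.exp (-Complex.I * x)‖ = 1 := by
  simpa using Complex.norm_exp_I_mul_ofReal (-x)

theorem aestronglyMeasurable_exp_neg_I_mul [MeasurableSpace α] {μ : Measure α} {θ : α → ℝ}
    (hθ : Measurable θ) : AEStronglyMeasurable (fun a => Complex.exp (-Complex.I * θ a)) μ :=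
  Measurable.aestronglyMeasurable (by fun_prop)

theorem integrable_exp_neg_I_mul_mul [MeasurableSpace α] {μ : Measure α} {f : α → ℂ}
    (hf : Integrable f μ) {θ : α → ℝ} (hθ : Measurable θ) :
    Integrable (fun a => Complex.exp (-Complex.I * θ a) * f a) μ :=
  hf.bdd_mul (aestronglyMeasurable_exp_neg_I_mul hθ)
    (.of_forall fun a => (norm_exp_neg_I_mul_ofReal (θ a)).le)

end Phase

section PartialFourier

variable {α : Type*} [MeasureSpace α] {F : α × ℝ → ℂ}

/-- The Fourier transform in the last variable: the change from the position to the momentum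
representation for a single degree of freedom of a composite system. -/
noncomputable def partialFourier (F : α × ℝ → ℂ) (z : α × ℝ) : ℂ :=
  fourierOne (fun y => F (z.1, y)) z.2

theorem aestronglyMeasurable_partialFourier (hF : AEStronglyMeasurable F) :
    AEStronglyMeasurable (partialFourier F) := by
  have hslice : ∀ᵐ z : α × ℝ, ∀ᵐ y, F (z.1, y) = hF.mk F (z.1, y) :=
    Measure.quasiMeasurePreserving_fst.ae (Measure.ae_ae_of_ae_prod hF.ae_eq_mk)
  have hmk : StronglyMeasurable (partialFourier (hF.mk F)) := by
    refine stronglyMeasurable_const.mul (StronglyMeasurable.integral_prod_right'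
      (f := fun w : (α × ℝ) × ℝ =>
        Complex.exp (-Complex.I * (w.1.2 * w.2 : ℝ)) * hF.mk F (w.1.1, w.2)) ?_)
    exact (Measurable.stronglyMeasurable (by fun_prop)).mul
      (hF.stronglyMeasurable_mk.comp_measurable (by fun_prop))
  refine ⟨_, hmk, ?_⟩
  filter_upwards [hslice] with z hz
  simp only [partialFourier, fourierOne]
  congr 1
  refine integral_congr_ae ?_
  filter_upwards [hz] with y hy
  rw [hy]

theorem integrable_partialFourier_slice (hF : Integrable F) (s : ℝ) :
    Integrable fun a => partialFourier F (a, s) :=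
  (integrable_exp_neg_I_mul_mul hF
    (measurable_const.mul measurable_snd : Measurable fun z : α × ℝ => s * z.2)
    ).integral_prod_left.const_mul _

theorem ae_memLp_two_slice {α β E : Type*} [MeasurableSpace α] [MeasurableSpace β]
    [NormedAddCommGroup E] {μ : Measure α} {ν : Measure β} [SFinite μ] [SFinite ν] {F : α × β → E}
    (hF : MemLp F 2 (μ.prod ν)) : ∀ᵐ a ∂μ, MemLp (fun b => F (a, b)) 2 ν := by
  have hsq := (memLp_two_iff_integrable_sq_norm hF.aestronglyMeasurable).1 hF
  filter_upwards [hF.aestronglyMeasurable.prodMk_left, hsq.prod_right_ae] with a hmeas hsq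
  exact (memLp_two_iff_integrable_sq_norm hmeas).2 hsq

variable [SFinite (volume : Measure α)]

theorem lintegral_enorm_sq_partialFourier (h₁ : Integrable F) (h₂ : MemLp F 2) :
    ∀ᵐ a, ∫⁻ s, ‖partialFourier F (a, s)‖ₑ ^ 2 = ∫⁻ y, ‖F (a, y)‖ₑ ^ 2 := by
  have hslice₁ : ∀ᵐ a, Integrable fun y => F (a, y) := h₁.prod_right_ae
  have hslice₂ : ∀ᵐ a, MemLp (fun y => F (a, y)) 2 := ae_memLp_two_slice h₂
  filter_upwards [hslice₁, hslice₂] with a ha₁ ha₂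
  simpa only [partialFourier] using lintegral_enorm_sq_fourierOne ha₁ ha₂

theorem memLp_partialFourier (h₁ : Integrable F) (h₂ : MemLp F 2) :
    MemLp (partialFourier F) 2 := by
  have hmeas := aestronglyMeasurable_partialFourier h₂.aestronglyMeasurable
  refine ⟨hmeas, ?_⟩
  have hnorm : eLpNorm (partialFourier F) 2 ^ 2 = eLpNorm F 2 ^ 2 := by
    rw [eLpNorm_two_sq_eq_lintegral, eLpNorm_two_sq_eq_lintegral, Measure.volume_eq_prod,
      lintegral_prod _ (hmeas.enorm.pow_const 2),
      lintegral_prod _ (h₂.aestronglyMeasurable.enorm.pow_const 2)]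
    exact lintegral_congr_ae (lintegral_enorm_sq_partialFourier h₁ h₂)
  exact (ENNReal.pow_lt_top_iff.1 (hnorm ▸ ENNReal.pow_lt_top h₂.2)).resolve_right two_ne_zero

theorem map_fst_bornLaw_partialFourier (h₁ : Integrable F) (h₂ : MemLp F 2) :
    (bornLaw (partialFourier F)).map Prod.fst = (bornLaw F).map Prod.fst := by
  rw [map_fst_bornLaw (aestronglyMeasurable_partialFourier h₂.aestronglyMeasurable),
    map_fst_bornLaw h₂.aestronglyMeasurable]
  exact withDensity_congr_ae (lintegral_enorm_sq_partialFourier h₁ h₂)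

end PartialFourier

section FourierTwo

variable {F : ℝ × ℝ → ℂ}

theorem continuous_fourierTwo (hF : Integrable F) : Continuous (fourierTwo F) := by
  refine continuous_const.mul (continuous_of_dominated (bound := fun z => ‖F z‖) (fun p => ?_)
    (fun p => .of_forall fun z => ?_) hF.norm (.of_forall fun z => by fun_prop))
  · exact (integrable_exp_neg_I_mul_mul hF (by fun_prop)).aestronglyMeasurable
  · rw [norm_mul, norm_exp_neg_I_mul_ofReal, one_mul]

theorem inv_sqrt_two_pi_mul_self :
    (((√(2 * Real.pi))⁻¹ : ℝ) : ℂ) * ((√(2 * Real.pi))⁻¹ : ℝ) = ((2 * Real.pi)⁻¹ : ℝ) := by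
  rw [← Complex.ofReal_mul, ← mul_inv, Real.mul_self_sqrt (by positivity)]

theorem fourierTwo_eq_fourierOne_partialFourier (hF : Integrable F) (p s : ℝ) :
    fourierTwo F (p, s) = fourierOne (fun x => partialFourier F (x, s)) p := by
  have hintegrable := integrable_exp_neg_I_mul_mul hF
    (by fun_prop : Measurable fun z : ℝ × ℝ => p * z.1 + s * z.2)
  simp only [fourierTwo, fourierOne, partialFourier]
  rw [← inv_sqrt_two_pi_mul_self, mul_assoc, Measure.volume_eq_prod, integral_prod _ hintegrable,
    ← integral_const_mul]
  congr 2
  funext x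
  rw [mul_left_comm, ← integral_const_mul (Complex.exp _)]
  congr 2
  funext y
  rw [← mul_assoc, ← Complex.exp_add]
  push_cast
  ring_nf

theorem lintegral_enorm_sq_fourierTwo (h₁ : Integrable F) (h₂ : MemLp F 2) :
    ∫⁻ p, ‖fourierTwo F p‖ₑ ^ 2 = ∫⁻ z, ‖F z‖ₑ ^ 2 := by
  have hpartial := memLp_partialFourier h₁ h₂
  have hswap : MemLp (partialFourier F ∘ Prod.swap) 2 :=
    hpartial.comp_measurePreserving Measure.measurePreserving_swap
  calc ∫⁻ p, ‖fourierTwo F p‖ₑ ^ 2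
      = ∫⁻ s, ∫⁻ p, ‖fourierOne (fun x => partialFourier F (x, s)) p‖ₑ ^ 2 := by
        rw [Measure.volume_eq_prod, lintegral_prod_symm _
          ((continuous_fourierTwo h₁).aestronglyMeasurable.enorm.pow_const 2)]
        simp_rw [fourierTwo_eq_fourierOne_partialFourier h₁]
    _ = ∫⁻ s, ∫⁻ x, ‖partialFourier F (x, s)‖ₑ ^ 2 := by
        refine lintegral_congr_ae ?_
        filter_upwards [ae_memLp_two_slice (μ := volume) (ν := volume) hswap] with s hs
        exact lintegral_enorm_sq_fourierOne (integrable_partialFourier_slice h₁ s) hs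
    _ = ∫⁻ x, ∫⁻ y, ‖F (x, y)‖ₑ ^ 2 := by
        rw [lintegral_lintegral_swap]
        · exact lintegral_congr_ae (lintegral_enorm_sq_partialFourier h₁ h₂)
        · exact hswap.aestronglyMeasurable.enorm.pow_const 2
    _ = ∫⁻ z, ‖F z‖ₑ ^ 2 := by
        rw [Measure.volume_eq_prod,
          lintegral_prod _ (h₂.aestronglyMeasurable.enorm.pow_const 2)]

end FourierTwo

section Shear

variable {α : Type*} [MeasureSpace α] [SFinite (volume : Measure α)]

theorem measurePreserving_shear_snd {c : α → ℝ} (hc : Measurable c) :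
    MeasurePreserving fun z : α × ℝ => (z.1, z.2 + c z.1) :=
  (MeasurePreserving.id volume).skew_product (by fun_prop)
    (.of_forall fun a => map_add_right_eq_self volume (c a))

theorem measurePreserving_shear_fst {c : α → ℝ} (hc : Measurable c) :
    MeasurePreserving fun z : ℝ × α => (z.1 + c z.2, z.2) :=
  (Measure.measurePreserving_swap.comp (measurePreserving_shear_snd hc)).comp
    Measure.measurePreserving_swap

theorem integral_comp_measurePreserving {α β : Type*} [MeasurableSpace α] [MeasurableSpace β]
    {μ : Measure α} {ν : Measure β} {f : β → ℂ} (hf : AEStronglyMeasurable f ν) {T : α → β}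
    (hT : MeasurePreserving T μ ν) : ∫ a, f (T a) ∂μ = ∫ b, f b ∂ν := by
  rw [← hT.map_eq] at hf ⊢
  exact (integral_map hT.aemeasurable hf).symm

end Shear

section Coupling

variable {lam mu kap : ℝ} {ψ : ℝ → ℂ} {φ : ℝ × ℝ → ℂ}

/-- The linear map of configuration space by composition with which the coupling acts on wave
functions. Its argument is `((q, q₁), q₂)`, since only `q₂` is Fourier transformed. -/
noncomputable def positionFlow (lam mu kap : ℝ) (z : (ℝ × ℝ) × ℝ) : ℝ × ℝ × ℝ :=
  (z.1.1 + mu * z.2, z.1.2 - lam * z.1.1 - lam * mu / 2 * (kap + 1) * z.2, z.2)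

/-- The inverse transpose of `positionFlow`, by composition with which the coupling acts on wave
functions in the momentum representation. -/
noncomputable def momentumFlow (lam mu kap : ℝ) (z : (ℝ × ℝ) × ℝ) : ℝ × ℝ × ℝ :=
  (z.1.1 + lam * z.1.2, z.1.2, z.2 - mu * z.1.1 + lam * mu / 2 * (kap - 1) * z.1.2)

/-- The wave function after the coupling, in the position representation. -/
noncomputable def coupledPosition (lam mu kap : ℝ) (φ : ℝ × ℝ → ℂ) (ψ : ℝ → ℂ) : (ℝ × ℝ) × ℝ → ℂ :=
  (fun v => ψ v.1 * φ v.2) ∘ positionFlow lam mu kap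

theorem coupledMixed_eq_partialFourier :
    coupledMixed lam mu kap φ ψ =
      partialFourier (coupledPosition lam mu kap φ ψ) ∘ MeasurableEquiv.prodAssoc.symm := by
  funext v
  simp [coupledMixed, coupled, evolve, partialFourier, coupledPosition, positionFlow,
    MeasurableEquiv.prodAssoc]

theorem measurePreserving_positionFlow : MeasurePreserving (positionFlow lam mu kap) := by
  have hassoc : MeasurePreserving (MeasurableEquiv.prodAssoc : (ℝ × ℝ) × ℝ ≃ᵐ ℝ × ℝ × ℝ) :=
    volume_preserving_prodAssoc
  have hsystem : MeasurePreserving fun v : ℝ × ℝ × ℝ => (v.1 + mu * v.2.2, v.2) :=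
    measurePreserving_shear_fst (c := fun w : ℝ × ℝ => mu * w.2) (by fun_prop)
  have hprobe : MeasurePreserving fun v : ℝ × ℝ × ℝ =>
      (v.1, v.2.1 + (-(lam * v.1) - lam * mu / 2 * (kap - 1) * v.2.2), v.2.2) :=
    (MeasurePreserving.id volume).skew_product (by fun_prop) (.of_forall fun u =>
      (measurePreserving_shear_fst
        (c := fun y => -(lam * u) - lam * mu / 2 * (kap - 1) * y) (by fun_prop)).map_eq)
  convert (hprobe.comp hsystem).comp hassoc using 1
  funext z
  ext <;> simp only [positionFlow, MeasurableEquiv.prodAssoc, MeasurableEquiv.coe_mk,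
    Function.comp_apply, Equiv.prodAssoc_apply]
  ring

theorem measurePreserving_momentumFlow : MeasurePreserving (momentumFlow lam mu kap) := by
  have hassoc : MeasurePreserving (MeasurableEquiv.prodAssoc : (ℝ × ℝ) × ℝ ≃ᵐ ℝ × ℝ × ℝ) :=
    volume_preserving_prodAssoc
  have hsystem : MeasurePreserving fun v : ℝ × ℝ × ℝ => (v.1 + lam * v.2.1, v.2) :=
    measurePreserving_shear_fst (c := fun w : ℝ × ℝ => lam * w.1) (by fun_prop)
  have hprobe : MeasurePreserving fun z : (ℝ × ℝ) × ℝ =>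
      (z.1, z.2 + (lam * mu / 2 * (kap - 1) * z.1.2 - mu * z.1.1)) :=
    measurePreserving_shear_snd
      (c := fun a : ℝ × ℝ => lam * mu / 2 * (kap - 1) * a.2 - mu * a.1) (by fun_prop)
  convert (hsystem.comp hassoc).comp hprobe using 1
  funext z
  ext <;> simp only [momentumFlow, MeasurableEquiv.prodAssoc, MeasurableEquiv.coe_mk,
    Function.comp_apply, Equiv.prodAssoc_apply]
  ring

theorem memLp_two_mul_prod {α β : Type*} [MeasurableSpace α] [MeasurableSpace β] {μ : Measure α}
    {ν : Measure β} {f : α → ℂ} {g : β → ℂ} (hf : MemLp f 2 μ) (hg : MemLp g 2 ν) :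
    MemLp (fun z : α × β => f z.1 * g z.2) 2 (μ.prod ν) := by
  refine (memLp_two_iff_integrable_sq_norm
    (hf.aestronglyMeasurable.comp_fst.mul hg.aestronglyMeasurable.comp_snd)).2 ?_
  simp only [Pi.mul_apply, norm_mul, mul_pow]
  exact ((memLp_two_iff_integrable_sq_norm hf.aestronglyMeasurable).1 hf).mul_prod
    ((memLp_two_iff_integrable_sq_norm hg.aestronglyMeasurable).1 hg)

theorem integrable_coupledPosition (hψ : Integrable ψ) (hφ : Integrable φ) :
    Integrable (coupledPosition lam mu kap φ ψ) :=
  measurePreserving_positionFlow.integrable_comp_of_integrable (hψ.mul_prod hφ)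

theorem memLp_coupledPosition (hψ : MemLp ψ 2) (hφ : MemLp φ 2) :
    MemLp (coupledPosition lam mu kap φ ψ) 2 :=
  (memLp_two_mul_prod hψ hφ).comp_measurePreserving measurePreserving_positionFlow

theorem purePointerLaw_eq_map (hψ : MemLp ψ 2) (hφ : MemLp φ 2) :
    purePointerLaw lam mu kap φ ψ =
      (bornLaw (partialFourier (coupledPosition lam mu kap φ ψ))).map
        fun z => (z.1.2, z.2) := by
  rw [← map_bornLaw_comp (aestronglyMeasurable_partialFourier
      (memLp_coupledPosition hψ hφ).aestronglyMeasurable)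
      (volume_preserving_prodAssoc.symm MeasurableEquiv.prodAssoc),
    ← coupledMixed_eq_partialFourier,
    Measure.map_map (by fun_prop) (MeasurableEquiv.measurable _)]
  rfl

theorem map_fst_purePointerLaw (hψ₁ : Integrable ψ) (hψ₂ : MemLp ψ 2) (hφ₁ : Integrable φ)
    (hφ₂ : MemLp φ 2) :
    (purePointerLaw lam mu kap φ ψ).map Prod.fst =
      ((bornLaw ψ).prod (bornLaw φ)).map
        fun v => lam * v.1 + v.2.1 + lam * mu / 2 * (kap - 1) * v.2.2 := by
  have hΨ := memLp_coupledPosition (lam := lam) (mu := mu) (kap := kap) hψ₂ hφ₂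
  have hproduct : AEStronglyMeasurable fun v : ℝ × ℝ × ℝ => ψ v.1 * φ v.2 :=
    (memLp_two_mul_prod hψ₂ hφ₂).aestronglyMeasurable
  calc (purePointerLaw lam mu kap φ ψ).map Prod.fst
      = ((bornLaw (partialFourier (coupledPosition lam mu kap φ ψ))).map Prod.fst).map
          Prod.snd := by
        rw [purePointerLaw_eq_map hψ₂ hφ₂, Measure.map_map (by fun_prop) (by fun_prop),
          Measure.map_map (by fun_prop) (by fun_prop)]
        rfl
    _ = (bornLaw (coupledPosition lam mu kap φ ψ)).map fun z => z.1.2 := by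
        rw [map_fst_bornLaw_partialFourier (integrable_coupledPosition hψ₁ hφ₁) hΨ,
          Measure.map_map (by fun_prop) (by fun_prop)]
        rfl
    _ = _ := by
        rw [← bornLaw_mul hψ₂.aestronglyMeasurable hφ₂.aestronglyMeasurable,
          ← map_bornLaw_comp hproduct (measurePreserving_positionFlow (kap := kap)),
          Measure.map_map (by fun_prop) measurePreserving_positionFlow.measurable]
        congr 1
        funext z
        simp only [Function.comp_apply, positionFlow]
        ring

theorem fourierTwo_partialFourier {F : (ℝ × ℝ) × ℝ → ℂ} (hF : Integrable F) (z : (ℝ × ℝ) × ℝ) :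
    fourierTwo (fun a => partialFourier F (a, z.2)) z.1 =
      ((2 * Real.pi)⁻¹ : ℝ) * (((√(2 * Real.pi))⁻¹ : ℝ) * ∫ w : (ℝ × ℝ) × ℝ,
        Complex.exp (-Complex.I * (z.1.1 * w.1.1 + z.1.2 * w.1.2 + z.2 * w.2 : ℝ)) * F w) := by
  have hintegrable := integrable_exp_neg_I_mul_mul hF
    (θ := fun w => z.1.1 * w.1.1 + z.1.2 * w.1.2 + z.2 * w.2) (by fun_prop)
  simp only [fourierTwo, fourierOne, partialFourier]
  rw [Measure.volume_eq_prod (ℝ × ℝ) ℝ, integral_prod _ hintegrable,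
    ← integral_const_mul (((√(2 * Real.pi))⁻¹ : ℝ) : ℂ)]
  congr 2
  funext a
  rw [mul_left_comm, ← integral_const_mul (Complex.exp _)]
  congr 2
  funext y
  rw [← mul_assoc, ← Complex.exp_add, ← mul_add, ← Complex.ofReal_add]

theorem fourierOne_mul_fourierTwo (f : ℝ → ℂ) (g : ℝ × ℝ → ℂ) (v : ℝ × ℝ × ℝ) :
    fourierOne f v.1 * fourierTwo g v.2 =
      ((2 * Real.pi)⁻¹ : ℝ) * (((√(2 * Real.pi))⁻¹ : ℝ) * ∫ w : ℝ × ℝ × ℝ,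
        Complex.exp (-Complex.I * (v.1 * w.1 + v.2.1 * w.2.1 + v.2.2 * w.2.2 : ℝ)) *
          (f w.1 * g w.2)) := by
  rw [fourierOne, fourierTwo, mul_mul_mul_comm, ← integral_prod_mul, mul_comm (Complex.ofReal _),
    mul_assoc]
  congr 3
  funext w
  rw [mul_mul_mul_comm, ← Complex.exp_add, ← mul_add, ← Complex.ofReal_add, add_assoc]

theorem momentumFlow_dot_positionFlow (z w : (ℝ × ℝ) × ℝ) :
    (momentumFlow lam mu kap z).1 * (positionFlow lam mu kap w).1 +
        (momentumFlow lam mu kap z).2.1 * (positionFlow lam mu kap w).2.1 +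
        (momentumFlow lam mu kap z).2.2 * (positionFlow lam mu kap w).2.2 =
      z.1.1 * w.1.1 + z.1.2 * w.1.2 + z.2 * w.2 := by
  simp only [momentumFlow, positionFlow]
  ring

theorem fourierTwo_partialFourier_coupledPosition (hψ : Integrable ψ) (hφ : Integrable φ)
    (z : (ℝ × ℝ) × ℝ) :
    fourierTwo (fun a => partialFourier (coupledPosition lam mu kap φ ψ) (a, z.2)) z.1 =
      fourierOne ψ (momentumFlow lam mu kap z).1 *
        fourierTwo φ (momentumFlow lam mu kap z).2 := by
  set v := momentumFlow lam mu kap z with hv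
  have hintegrable := integrable_exp_neg_I_mul_mul (hψ.mul_prod hφ)
    (θ := fun w => v.1 * w.1 + v.2.1 * w.2.1 + v.2.2 * w.2.2) (by fun_prop)
  rw [fourierTwo_partialFourier (integrable_coupledPosition hψ hφ), fourierOne_mul_fourierTwo]
  congr 2
  refine Eq.trans ?_ (integral_comp_measurePreserving hintegrable.aestronglyMeasurable
    (measurePreserving_positionFlow (lam := lam) (mu := mu) (kap := kap)))
  simp only [hv, momentumFlow_dot_positionFlow]
  rfl

theorem map_snd_purePointerLaw (hψ₁ : Integrable ψ) (hψ₂ : MemLp ψ 2) (hφ₁ : Integrable φ)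
    (hφ₂ : MemLp φ 2) :
    (purePointerLaw lam mu kap φ ψ).map Prod.snd =
      ((bornLaw (fourierOne ψ)).prod (bornLaw (fourierTwo φ))).map
        fun v => mu * v.1 + v.2.2 - lam * mu / 2 * (kap + 1) * v.2.1 := by
  have hΨ₁ := integrable_coupledPosition (lam := lam) (mu := mu) (kap := kap) hψ₁ hφ₁
  have hΨ₂ := memLp_coupledPosition (lam := lam) (mu := mu) (kap := kap) hψ₂ hφ₂
  have hswap : MemLp (partialFourier (coupledPosition lam mu kap φ ψ) ∘ Prod.swap) 2 :=
    (memLp_partialFourier hΨ₁ hΨ₂).comp_measurePreserving Measure.measurePreserving_swap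
  have hψ' := (continuous_fourierOne hψ₁).aestronglyMeasurable (μ := volume)
  have hφ' := (continuous_fourierTwo hφ₁).aestronglyMeasurable (μ := volume)
  have hproduct : AEStronglyMeasurable fun v : ℝ × ℝ × ℝ => fourierOne ψ v.1 * fourierTwo φ v.2 :=
    hψ'.comp_fst.mul hφ'.comp_snd
  have hPlancherel : ∀ᵐ s : ℝ,
      ∫⁻ a, ‖partialFourier (coupledPosition lam mu kap φ ψ) (a, s)‖ₑ ^ 2 =
        ∫⁻ a : ℝ × ℝ, ‖((fun v : ℝ × ℝ × ℝ => fourierOne ψ v.1 * fourierTwo φ v.2) ∘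
          momentumFlow lam mu kap) (a, s)‖ₑ ^ 2 := by
    have hslice : ∀ᵐ s, MemLp (fun a => partialFourier (coupledPosition lam mu kap φ ψ) (a, s)) 2 :=
      ae_memLp_two_slice hswap
    filter_upwards [hslice] with s hs
    rw [← lintegral_enorm_sq_fourierTwo (integrable_partialFourier_slice hΨ₁ s) hs]
    exact lintegral_congr fun a =>
      congrArg (‖·‖ₑ ^ 2) (fourierTwo_partialFourier_coupledPosition hψ₁ hφ₁ (a, s))
  rw [purePointerLaw_eq_map hψ₂ hφ₂, Measure.map_map (by fun_prop) (by fun_prop),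
    show Prod.snd ∘ (fun z : (ℝ × ℝ) × ℝ => (z.1.2, z.2)) = Prod.snd from rfl,
    map_snd_bornLaw (memLp_partialFourier hΨ₁ hΨ₂).aestronglyMeasurable,
    withDensity_congr_ae hPlancherel,
    ← map_snd_bornLaw (hproduct.comp_measurePreserving measurePreserving_momentumFlow),
    ← bornLaw_mul hψ' hφ',
    ← map_bornLaw_comp hproduct (measurePreserving_momentumFlow (kap := kap)),
    Measure.map_map (by fun_prop) measurePreserving_momentumFlow.measurable]
  congr 1
  funext z
  simp only [Function.comp_apply, momentumFlow]
  ring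

end Coupling

section SecondMoments

theorem lintegral_enorm_sq_eq_one {α : Type*} [MeasurableSpace α] {μ : Measure α} {f : α → ℂ}
    (hf : MemLp f 2 μ) (h : ∫ a, ‖f a‖ ^ 2 ∂μ = 1) : ∫⁻ a, ‖f a‖ₑ ^ 2 ∂μ = 1 := by
  have hsq := ofReal_integral_eq_lintegral_ofReal
    ((memLp_two_iff_integrable_sq_norm hf.aestronglyMeasurable).1 hf)
    (ae_of_all _ fun a => sq_nonneg ‖f a‖)
  rw [h, ENNReal.ofReal_one] at hsq
  simp only [hsq, ENNReal.ofReal_pow (norm_nonneg _), ofReal_norm]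

theorem isProbabilityMeasure_bornLaw {α : Type*} [MeasureSpace α] {f : α → ℂ}
    (hf : ∫⁻ a, ‖f a‖ₑ ^ 2 = 1) : IsProbabilityMeasure (bornLaw f) :=
  ⟨by rw [bornLaw, withDensity_apply _ .univ, setLIntegral_univ, hf]⟩

theorem memLp_id_bornLaw {f : ℝ → ℂ} (hf : AEStronglyMeasurable f)
    (h : Integrable fun q => q ^ 2 * ‖f q‖ ^ 2) : MemLp id 2 (bornLaw f) := by
  rw [memLp_two_iff_integrable_sq measurable_id.aestronglyMeasurable, bornLaw,
    integrable_withDensity_iff_integrable_smul₀' (hf.enorm.pow_const 2)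
      (ae_of_all _ fun q => ENNReal.pow_lt_top enorm_lt_top)]
  simpa only [ENNReal.toReal_pow, toReal_enorm, smul_eq_mul, mul_comm, id_eq] using h

theorem integrable_of_integrable_sq_mul_norm_sq {f : ℝ → ℂ} (hf : MemLp f 2)
    (h : Integrable fun q => q ^ 2 * ‖f q‖ ^ 2) : Integrable f := by
  have hweighted : MemLp (fun q => √(1 + q ^ 2) * ‖f q‖) 2 := by
    rw [memLp_two_iff_integrable_sq (by
      exact (by fun_prop : Continuous fun q : ℝ => √(1 + q ^ 2)).aestronglyMeasurable.mul
        hf.aestronglyMeasurable.norm)]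
    refine (((memLp_two_iff_integrable_sq_norm hf.aestronglyMeasurable).1 hf).add h).congr
      (ae_of_all _ fun q => ?_)
    simp only [Pi.add_apply, mul_pow, Real.sq_sqrt (by positivity : (0 : ℝ) ≤ 1 + q ^ 2)]
    ring
  have hweight : MemLp (fun q : ℝ => (√(1 + q ^ 2))⁻¹) 2 := by
    rw [memLp_two_iff_integrable_sq (by fun_prop)]
    refine integrable_inv_one_add_sq.congr (ae_of_all _ fun q => ?_)
    simp only [inv_pow, Real.sq_sqrt (by positivity : (0 : ℝ) ≤ 1 + q ^ 2)]
  refine (hweight.integrable_mul hweighted).mono' hf.aestronglyMeasurable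
    (ae_of_all _ fun q => le_of_eq ?_)
  have : √(1 + q ^ 2) ≠ 0 := by positivity
  simp [this]

end SecondMoments

namespace IsSystemState

variable {ψ : ℝ → ℂ} (h : IsSystemState ψ)
include h

theorem integrable : Integrable ψ := integrable_of_integrable_sq_mul_norm_sq h.memLp h.pos_moment

theorem lintegral_enorm_sq : ∫⁻ q, ‖ψ q‖ₑ ^ 2 = 1 := lintegral_enorm_sq_eq_one h.memLp h.norm_one

theorem continuous_fourierOne : Continuous (fourierOne ψ) :=
  ArthursKelly.continuous_fourierOne h.integrable

theorem hasVariance_bornLaw : HasVariance (bornLaw ψ) :=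
  ⟨isProbabilityMeasure_bornLaw h.lintegral_enorm_sq,
    memLp_id_bornLaw h.memLp.aestronglyMeasurable h.pos_moment⟩

theorem hasVariance_bornLaw_fourierOne : HasVariance (bornLaw (fourierOne ψ)) :=
  ⟨isProbabilityMeasure_bornLaw
      ((lintegral_enorm_sq_fourierOne h.integrable h.memLp).trans h.lintegral_enorm_sq),
    memLp_id_bornLaw h.continuous_fourierOne.aestronglyMeasurable h.mom_moment⟩

end IsSystemState

/-- A probability measure on the plane with finite second moments. -/
structure HasSecondMoments (ν : Measure (ℝ × ℝ)) : Prop where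
  isProbabilityMeasure : IsProbabilityMeasure ν
  memLp_fst : MemLp Prod.fst 2 ν
  memLp_snd : MemLp Prod.snd 2 ν

/-- A probe preparation whose positions and momenta have finite second moments. Its waves are
integrable, so that `fourierTwo` is their Fourier transform. -/
structure IsProbeState (σ : ProbeEnsemble) : Prop where
  integrable : ∀ i, Integrable (σ.wave i)
  memLp : ∀ i, MemLp (σ.wave i) 2
  position : HasSecondMoments (positionLaw σ)
  momentum : HasSecondMoments (momentumLaw σ)

theorem HasVariance.map_prod_add {α : Type*} [MeasurableSpace α] {μ : Measure ℝ} {ν : Measure α}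
    [IsProbabilityMeasure ν] {Y : α → ℝ} (hμ : HasVariance μ) (hY : MemLp Y 2 ν) :
    HasVariance ((μ.prod ν).map fun v => v.1 + Y v.2) := by
  have := hμ.1
  have hsum : MemLp (fun v : ℝ × α => v.1 + Y v.2) 2 (μ.prod ν) :=
    (hμ.2.comp_measurePreserving measurePreserving_fst).add
      (hY.comp_measurePreserving measurePreserving_snd)
  have hsum' := hsum.aestronglyMeasurable.aemeasurable
  exact ⟨Measure.isProbabilityMeasure_map hsum',
    (memLp_map_measure_iff measurable_id.aestronglyMeasurable hsum').2 hsum⟩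

theorem variance_map_prod_add {α : Type*} [MeasurableSpace α] {μ : Measure ℝ} {ν : Measure α}
    [IsProbabilityMeasure ν] {Y : α → ℝ} (hμ : HasVariance μ) (hY : MemLp Y 2 ν) :
    Var[id; (μ.prod ν).map fun v => v.1 + Y v.2] = Var[id; μ] + Var[Y; ν] := by
  have := hμ.1
  have hsum : AEMeasurable (fun v : ℝ × α => v.1 + Y v.2) (μ.prod ν) :=
    (measurable_fst.aemeasurable).add
      (hY.comp_measurePreserving measurePreserving_snd).aestronglyMeasurable.aemeasurable
  rw [variance_map measurable_id.aemeasurable hsum, Function.id_comp]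
  exact variance_add_prod (X := id) hμ.2 hY

namespace HasSecondMoments

variable {ν : Measure (ℝ × ℝ)} (hν : HasSecondMoments ν) (a b : ℝ)
include hν

theorem memLp_linear_combination : MemLp (fun z => a * z.1 + b * z.2) 2 ν :=
  (hν.memLp_fst.const_mul a).add (hν.memLp_snd.const_mul b)

theorem variance_linear_combination :
    Var[fun z => a * z.1 + b * z.2; ν] = a ^ 2 * Var[Prod.fst; ν]
      + 2 * (a * b) * cov[Prod.fst, Prod.snd; ν] + b ^ 2 * Var[Prod.snd; ν] := by
  have := hν.isProbabilityMeasure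
  rw [variance_fun_add (hν.memLp_fst.const_mul a) (hν.memLp_snd.const_mul b),
    variance_const_mul, variance_const_mul, covariance_const_mul_left, covariance_const_mul_right]
  ring

end HasSecondMoments

theorem prod_sum_smul {α β ι : Type*} [MeasurableSpace α] [MeasurableSpace β] [Fintype ι]
    (μ : Measure α) (c : ι → ENNReal) (ν : ι → Measure β) [∀ i, SFinite (ν i)] :
    μ.prod (∑ i, c i • ν i) = ∑ i, c i • μ.prod (ν i) := by
  simp only [← Measure.sum_fintype, Measure.prod_sum_right, Measure.prod_smul_right]

section Readings

variable {lam mu kap : ℝ} {σ : ProbeEnsemble} {ψ : ℝ → ℂ}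

theorem lawE_eq_map (hσ : IsProbeState σ) (hψ : IsSystemState ψ) (hlam : lam ≠ 0) :
    lawE lam mu kap σ ψ = ((bornLaw ψ).prod (positionLaw σ)).map
      fun v => v.1 + (lam⁻¹ * v.2.1 + mu / 2 * (kap - 1) * v.2.2) := by
  have hwave (i) : (purePointerLaw lam mu kap (σ.wave i) ψ).map (fun z => z.1 / lam) =
      ((bornLaw ψ).prod (bornLaw (σ.wave i))).map
        fun v => v.1 + (lam⁻¹ * v.2.1 + mu / 2 * (kap - 1) * v.2.2) := by
    change Measure.map ((fun t => t / lam) ∘ Prod.fst) _ = _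
    rw [← Measure.map_map (by fun_prop) measurable_fst,
      map_fst_purePointerLaw hψ.integrable hψ.memLp (hσ.integrable i) (hσ.memLp i),
      Measure.map_map (by fun_prop) (by fun_prop)]
    congr 1 with v
    simp only [Function.comp_apply]
    field_simp
    ring
  have hposition : positionLaw σ = ∑ i, ENNReal.ofReal (σ.weight i) • bornLaw (σ.wave i) := rfl
  rw [lawE, pointerLaw, hposition, prod_sum_smul, Measure.map_finset_sum' (by fun_prop),
    Measure.map_finset_sum' (by fun_prop)]
  simp only [Measure.map_smul, hwave]

theorem lawF_eq_map (hσ : IsProbeState σ) (hψ : IsSystemState ψ) (hmu : mu ≠ 0) :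
    lawF lam mu kap σ ψ = ((bornLaw (fourierOne ψ)).prod (momentumLaw σ)).map
      fun v => v.1 + (-(lam / 2 * (kap + 1)) * v.2.1 + mu⁻¹ * v.2.2) := by
  have hwave (i) : (purePointerLaw lam mu kap (σ.wave i) ψ).map (fun z => z.2 / mu) =
      ((bornLaw (fourierOne ψ)).prod (bornLaw (fourierTwo (σ.wave i)))).map
        fun v => v.1 + (-(lam / 2 * (kap + 1)) * v.2.1 + mu⁻¹ * v.2.2) := by
    change Measure.map ((fun t => t / mu) ∘ Prod.snd) _ = _
    rw [← Measure.map_map (by fun_prop) measurable_snd,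
      map_snd_purePointerLaw hψ.integrable hψ.memLp (hσ.integrable i) (hσ.memLp i),
      Measure.map_map (by fun_prop) (by fun_prop)]
    congr 1 with v
    simp only [Function.comp_apply]
    field_simp
    ring
  have hmomentum : momentumLaw σ =
      ∑ i, ENNReal.ofReal (σ.weight i) • bornLaw (fourierTwo (σ.wave i)) := rfl
  rw [lawF, pointerLaw, hmomentum, prod_sum_smul, Measure.map_finset_sum' (by fun_prop),
    Measure.map_finset_sum' (by fun_prop)]
  simp only [Measure.map_smul, hwave]

theorem hasVariance_lawE (hσ : IsProbeState σ) (hψ : IsSystemState ψ) (hlam : lam ≠ 0) :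
    HasVariance (lawE lam mu kap σ ψ) := by
  have := hσ.position.isProbabilityMeasure
  rw [lawE_eq_map hσ hψ hlam]
  exact hψ.hasVariance_bornLaw.map_prod_add (hσ.position.memLp_linear_combination _ _)

theorem hasVariance_lawF (hσ : IsProbeState σ) (hψ : IsSystemState ψ) (hmu : mu ≠ 0) :
    HasVariance (lawF lam mu kap σ ψ) := by
  have := hσ.momentum.isProbabilityMeasure
  rw [lawF_eq_map hσ hψ hmu]
  exact hψ.hasVariance_bornLaw_fourierOne.map_prod_add (hσ.momentum.memLp_linear_combination _ _)

theorem variance_lawE (hσ : IsProbeState σ) (hψ : IsSystemState ψ) (hlam : lam ≠ 0) :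
    Var[id; lawE lam mu kap σ ψ] = Var[id; bornLaw ψ] +
      (lam⁻¹ ^ 2 * Var[Prod.fst; positionLaw σ] + 2 * (lam⁻¹ * (mu / 2 * (kap - 1))) * covQ σ
        + (mu / 2 * (kap - 1)) ^ 2 * Var[Prod.snd; positionLaw σ]) := by
  have := hσ.position.isProbabilityMeasure
  rw [lawE_eq_map hσ hψ hlam, covQ, ← hσ.position.variance_linear_combination]
  exact variance_map_prod_add hψ.hasVariance_bornLaw (hσ.position.memLp_linear_combination _ _)

theorem variance_lawF (hσ : IsProbeState σ) (hψ : IsSystemState ψ) (hmu : mu ≠ 0) :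
    Var[id; lawF lam mu kap σ ψ] = Var[id; bornLaw (fourierOne ψ)] +
      ((-(lam / 2 * (kap + 1))) ^ 2 * Var[Prod.fst; momentumLaw σ]
        + 2 * (-(lam / 2 * (kap + 1)) * mu⁻¹) * covP σ
        + mu⁻¹ ^ 2 * Var[Prod.snd; momentumLaw σ]) := by
  have := hσ.momentum.isProbabilityMeasure
  rw [lawF_eq_map hσ hψ hmu, covP, ← hσ.momentum.variance_linear_combination]
  exact variance_map_prod_add hψ.hasVariance_bornLaw_fourierOne
    (hσ.momentum.memLp_linear_combination _ _)

theorem focusDefined (hσ : IsProbeState σ) (hψ : IsSystemState ψ) (hlam : lam ≠ 0)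
    (hmu : mu ≠ 0) : FocusDefined lam mu kap σ ψ :=
  ⟨hasVariance_lawE hσ hψ hlam, hasVariance_lawE hσ hψ hlam, hasVariance_lawF hσ hψ hmu,
    hasVariance_lawF hσ hψ hmu⟩

theorem focusQ_eq (hσ : IsProbeState σ) (hψ : IsSystemState ψ) (hlam : lam ≠ 0) :
    focusQ lam mu kap σ ψ = -(lam * mu / lam ^ 2 *
      ((1 - kap) * (covQ σ - lam * mu / 4 * (1 - kap) * Var[Prod.snd; positionLaw σ]))) := by
  rw [focusQ, variance_lawE hσ hψ hlam, variance_lawE hσ hψ hlam]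
  field_simp
  ring

theorem focusP_eq (hσ : IsProbeState σ) (hψ : IsSystemState ψ) (hmu : mu ≠ 0) :
    focusP lam mu kap σ ψ = -(lam * mu / mu ^ 2 *
      ((1 + kap) * (covP σ - lam * mu / 4 * (1 + kap) * Var[Prod.fst; momentumLaw σ]))) := by
  rw [focusP, variance_lawF hσ hψ hmu, variance_lawF hσ hψ hmu]
  field_simp
  ring

theorem jointFocusing_iff (hσ : IsProbeState σ) (hψ : IsSystemState ψ) (hcoupling : 0 < lam * mu) :
    JointFocusing lam mu kap σ ψ ↔
      0 < (1 - kap) * (covQ σ - lam * mu / 4 * (1 - kap) * Var[Prod.snd; positionLaw σ]) ∧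
      0 < (1 + kap) * (covP σ - lam * mu / 4 * (1 + kap) * Var[Prod.fst; momentumLaw σ]) := by
  have hlam : lam ≠ 0 := left_ne_zero_of_mul hcoupling.ne'
  have hmu : mu ≠ 0 := right_ne_zero_of_mul hcoupling.ne'
  rw [JointFocusing, focusQ_eq hσ hψ hlam, focusP_eq hσ hψ hmu, neg_lt_zero, neg_lt_zero,
    mul_pos_iff_of_pos_left (div_pos hcoupling (by positivity)),
    mul_pos_iff_of_pos_left (div_pos hcoupling (by positivity))]

end Readings

theorem positionLaw_pure (φ : ℝ × ℝ → ℂ) : positionLaw (.pure φ) = bornLaw φ := by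
  change ∑ i : Fin 1, ENNReal.ofReal (![1] i) • bornLaw (![φ] i) = _
  simp

theorem momentumLaw_pure (φ : ℝ × ℝ → ℂ) :
    momentumLaw (.pure φ) = bornLaw (fourierTwo φ) := by
  change ∑ i : Fin 1, ENNReal.ofReal (![1] i) • bornLaw (fourierTwo (![φ] i)) = _
  simp

theorem variance_bornLaw_pos {f : ℝ → ℂ} (h : HasVariance (bornLaw f)) :
    0 < Var[id; bornLaw f] := by
  have := h.1
  refine (variance_nonneg _ _).lt_of_ne' fun hzero => ?_
  have hevar : evariance id (bornLaw f) = 0 := by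
    rw [← h.2.ofReal_variance_eq, hzero, ENNReal.ofReal_zero]
  have hconst := (evariance_eq_zero_iff measurable_id.aemeasurable).1 hevar
  have hnull : bornLaw f {∫ q, q ∂bornLaw f} = 0 :=
    withDensity_absolutelyContinuous _ _ Real.volume_singleton
  have hfull : bornLaw f {∫ q, q ∂bornLaw f}ᶜ = 0 := hconst
  exact one_ne_zero ((measure_univ (μ := bornLaw f)).symm.trans
    (by rw [← measure_add_measure_compl (measurableSet_singleton _), hnull, hfull, add_zero]))

theorem HasVariance.prod {μ ν : Measure ℝ} (hμ : HasVariance μ) (hν : HasVariance ν) :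
    HasSecondMoments (μ.prod ν) := by
  have := hμ.1
  have := hν.1
  exact ⟨inferInstance, hμ.2.comp_measurePreserving measurePreserving_fst,
    hν.2.comp_measurePreserving measurePreserving_snd⟩

theorem variance_fst_prod {μ ν : Measure ℝ} [IsProbabilityMeasure ν] :
    Var[Prod.fst; μ.prod ν] = Var[id; μ] := by
  have h : (μ.prod ν).map Prod.fst = μ := measurePreserving_fst.map_eq
  conv_rhs => rw [← h, variance_map measurable_id.aemeasurable measurable_fst.aemeasurable]
  rfl

theorem variance_snd_prod {μ ν : Measure ℝ} [IsProbabilityMeasure μ] [SFinite ν] :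
    Var[Prod.snd; μ.prod ν] = Var[id; ν] := by
  have h : (μ.prod ν).map Prod.snd = ν := measurePreserving_snd.map_eq
  conv_rhs => rw [← h, variance_map measurable_id.aemeasurable measurable_snd.aemeasurable]
  rfl

theorem HasVariance.covariance_prod {μ ν : Measure ℝ} (hμ : HasVariance μ) (hν : HasVariance ν) :
    cov[Prod.fst, Prod.snd; μ.prod ν] = 0 := by
  have := hμ.1
  have := hν.1
  exact covariance_fst_snd_prod hμ.2 hν.2

namespace HasSecondMoments

variable {ν : Measure (ℝ × ℝ)} (hν : HasSecondMoments ν) (c : ℝ)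
include hν

theorem map_shear_fst : HasSecondMoments (ν.map fun z => (z.1 + c * z.2, z.2)) := by
  have := hν.isProbabilityMeasure
  have hT : Measurable fun z : ℝ × ℝ => (z.1 + c * z.2, z.2) := by fun_prop
  exact ⟨Measure.isProbabilityMeasure_map hT.aemeasurable,
    (memLp_map_measure_iff measurable_fst.aestronglyMeasurable hT.aemeasurable).2
      (hν.memLp_fst.add (hν.memLp_snd.const_mul c)),
    (memLp_map_measure_iff measurable_snd.aestronglyMeasurable hT.aemeasurable).2 hν.memLp_snd⟩

theorem map_shear_snd : HasSecondMoments (ν.map fun z => (z.1, z.2 + c * z.1)) := by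
  have := hν.isProbabilityMeasure
  have hT : Measurable fun z : ℝ × ℝ => (z.1, z.2 + c * z.1) := by fun_prop
  exact ⟨Measure.isProbabilityMeasure_map hT.aemeasurable,
    (memLp_map_measure_iff measurable_fst.aestronglyMeasurable hT.aemeasurable).2 hν.memLp_fst,
    (memLp_map_measure_iff measurable_snd.aestronglyMeasurable hT.aemeasurable).2
      (hν.memLp_snd.add (hν.memLp_fst.const_mul c))⟩

theorem covariance_map_shear_fst :
    cov[Prod.fst, Prod.snd; ν.map fun z => (z.1 + c * z.2, z.2)] =
      cov[Prod.fst, Prod.snd; ν] + c * Var[Prod.snd; ν] := by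
  have := hν.isProbabilityMeasure
  rw [covariance_map measurable_fst.aestronglyMeasurable measurable_snd.aestronglyMeasurable
    (by fun_prop)]
  change cov[Prod.fst + fun z => c * z.2, Prod.snd; ν] = _
  rw [covariance_add_left hν.memLp_fst (hν.memLp_snd.const_mul c) hν.memLp_snd,
    covariance_const_mul_left, covariance_self measurable_snd.aemeasurable]

theorem covariance_map_shear_snd :
    cov[Prod.fst, Prod.snd; ν.map fun z => (z.1, z.2 + c * z.1)] =
      cov[Prod.fst, Prod.snd; ν] + c * Var[Prod.fst; ν] := by
  have := hν.isProbabilityMeasure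
  rw [covariance_map measurable_fst.aestronglyMeasurable measurable_snd.aestronglyMeasurable
    (by fun_prop)]
  change cov[Prod.fst, Prod.snd + fun z => c * z.1; ν] = _
  rw [covariance_add_right hν.memLp_fst hν.memLp_snd (hν.memLp_fst.const_mul c),
    covariance_const_mul_right, covariance_self measurable_fst.aemeasurable]

end HasSecondMoments

theorem variance_snd_map_shear_fst (ν : Measure (ℝ × ℝ)) (c : ℝ) :
    Var[Prod.snd; ν.map fun z => (z.1 + c * z.2, z.2)] = Var[Prod.snd; ν] :=
  variance_map measurable_snd.aemeasurable (by fun_prop)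

theorem variance_fst_map_shear_snd (ν : Measure (ℝ × ℝ)) (c : ℝ) :
    Var[Prod.fst; ν.map fun z => (z.1, z.2 + c * z.1)] = Var[Prod.fst; ν] :=
  variance_map measurable_fst.aemeasurable (by fun_prop)

/-- The product of the single-mode wave functions `f` and `g`, composed with a shear that couples
the first mode to the second with strength `r`. -/
noncomputable def shearedProduct (r : ℝ) (f g : ℝ → ℂ) (z : ℝ × ℝ) : ℂ := f (z.1 + r * z.2) * g z.2

section ShearedProduct

variable {r : ℝ} {f g : ℝ → ℂ}

theorem measurePreserving_shear_mul_fst (r : ℝ) :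
    MeasurePreserving fun z : ℝ × ℝ => (z.1 + r * z.2, z.2) :=
  measurePreserving_shear_fst (c := fun y => r * y) (by fun_prop)

theorem integrable_shearedProduct (hf : Integrable f) (hg : Integrable g) :
    Integrable (shearedProduct r f g) :=
  (measurePreserving_shear_mul_fst r).integrable_comp_of_integrable (hf.mul_prod hg)

theorem memLp_shearedProduct (hf : MemLp f 2) (hg : MemLp g 2) :
    MemLp (shearedProduct r f g) 2 :=
  (memLp_two_mul_prod hf hg).comp_measurePreserving (measurePreserving_shear_mul_fst r)

theorem bornLaw_shearedProduct (hf : AEStronglyMeasurable f) (hg : AEStronglyMeasurable g) :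
    bornLaw (shearedProduct r f g) =
      ((bornLaw f).prod (bornLaw g)).map fun w => (w.1 + -r * w.2, w.2) := by
  have hproduct : AEStronglyMeasurable fun z : ℝ × ℝ => f z.1 * g z.2 :=
    hf.comp_fst.mul hg.comp_snd
  rw [← bornLaw_mul hf hg, ← map_bornLaw_comp hproduct (measurePreserving_shear_mul_fst r),
    Measure.map_map (by fun_prop) (by fun_prop)]
  simp only [Function.comp_def, neg_mul, add_neg_cancel_right, Prod.mk.eta, Measure.map_id']
  rfl

theorem fourierTwo_shearedProduct (hf : Integrable f) (hg : Integrable g) :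
    fourierTwo (shearedProduct r f g) =
      fun p => fourierOne f p.1 * fourierOne g (p.2 + -r * p.1) := by
  funext p
  have hintegrable := integrable_exp_neg_I_mul_mul (hf.mul_prod hg)
    (θ := fun w : ℝ × ℝ => p.1 * w.1 + (p.2 + -r * p.1) * w.2) (by fun_prop)
  rw [fourierOne, fourierOne, mul_mul_mul_comm, inv_sqrt_two_pi_mul_self,
    ← integral_prod_mul, fourierTwo]
  congr 1
  calc ∫ q : ℝ × ℝ, Complex.exp (-Complex.I * (p.1 * q.1 + p.2 * q.2 : ℝ)) * shearedProduct r f g q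
      = ∫ q : ℝ × ℝ, Complex.exp (-Complex.I * (p.1 * (q.1 + r * q.2) +
          (p.2 + -r * p.1) * q.2 : ℝ)) * (f (q.1 + r * q.2) * g q.2) := by
        congr 1 with q
        rw [shearedProduct]
        congr 4
        ring
    _ = ∫ w : ℝ × ℝ, Complex.exp (-Complex.I * (p.1 * w.1 + (p.2 + -r * p.1) * w.2 : ℝ)) *
          (f w.1 * g w.2) :=
        integral_comp_measurePreserving hintegrable.aestronglyMeasurable
          (measurePreserving_shear_mul_fst r)
    _ = _ := by
        congr 1 with w
        rw [mul_mul_mul_comm, ← Complex.exp_add, ← mul_add, ← Complex.ofReal_add]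

theorem bornLaw_fourierTwo_shearedProduct (hf : Integrable f) (hg : Integrable g) :
    bornLaw (fourierTwo (shearedProduct r f g)) =
      ((bornLaw (fourierOne f)).prod (bornLaw (fourierOne g))).map
        fun w => (w.1, w.2 + r * w.1) := by
  have hf' := (continuous_fourierOne hf).aestronglyMeasurable (μ := volume)
  have hg' := (continuous_fourierOne hg).aestronglyMeasurable (μ := volume)
  have hproduct : AEStronglyMeasurable fun z : ℝ × ℝ => fourierOne f z.1 * fourierOne g z.2 :=
    hf'.comp_fst.mul hg'.comp_snd
  rw [← bornLaw_mul hf' hg', ← map_bornLaw_comp hproduct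
      (measurePreserving_shear_snd (c := fun x => -r * x) (by fun_prop)),
    Measure.map_map (by fun_prop) (by fun_prop), fourierTwo_shearedProduct hf hg]
  simp only [Function.comp_def, neg_mul, neg_add_cancel_right, Prod.mk.eta, Measure.map_id']

theorem positionLaw_shearedProduct (hf : IsSystemState f) (hg : IsSystemState g) :
    positionLaw (.pure (shearedProduct r f g)) =
      ((bornLaw f).prod (bornLaw g)).map fun w => (w.1 + -r * w.2, w.2) :=
  (positionLaw_pure _).trans
    (bornLaw_shearedProduct hf.memLp.aestronglyMeasurable hg.memLp.aestronglyMeasurable)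

theorem momentumLaw_shearedProduct (hf : IsSystemState f) (hg : IsSystemState g) :
    momentumLaw (.pure (shearedProduct r f g)) =
      ((bornLaw (fourierOne f)).prod (bornLaw (fourierOne g))).map
        fun w => (w.1, w.2 + r * w.1) :=
  (momentumLaw_pure _).trans (bornLaw_fourierTwo_shearedProduct hf.integrable hg.integrable)

theorem isProbeState_shearedProduct (hf : IsSystemState f) (hg : IsSystemState g) :
    IsProbeState (.pure (shearedProduct r f g)) where
  integrable i := by
    change Fin 1 at i
    fin_cases i
    exact integrable_shearedProduct hf.integrable hg.integrable
  memLp i := by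
    change Fin 1 at i
    fin_cases i
    exact memLp_shearedProduct hf.memLp hg.memLp
  position := by
    rw [positionLaw_shearedProduct hf hg]
    exact (hf.hasVariance_bornLaw.prod hg.hasVariance_bornLaw).map_shear_fst (-r)
  momentum := by
    rw [momentumLaw_shearedProduct hf hg]
    exact (hf.hasVariance_bornLaw_fourierOne.prod hg.hasVariance_bornLaw_fourierOne).map_shear_snd r

theorem variance_snd_positionLaw_shearedProduct (hf : IsSystemState f) (hg : IsSystemState g) :
    Var[Prod.snd; positionLaw (.pure (shearedProduct r f g))] = Var[id; bornLaw g] := by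
  have := hf.hasVariance_bornLaw.1
  rw [positionLaw_shearedProduct hf hg, variance_snd_map_shear_fst, variance_snd_prod]

theorem variance_fst_momentumLaw_shearedProduct (hf : IsSystemState f) (hg : IsSystemState g) :
    Var[Prod.fst; momentumLaw (.pure (shearedProduct r f g))] =
      Var[id; bornLaw (fourierOne f)] := by
  have := hg.hasVariance_bornLaw_fourierOne.1
  rw [momentumLaw_shearedProduct hf hg, variance_fst_map_shear_snd, variance_fst_prod]

theorem covQ_shearedProduct (hf : IsSystemState f) (hg : IsSystemState g) :
    covQ (.pure (shearedProduct r f g)) = -r * Var[id; bornLaw g] := by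
  have hf' := hf.hasVariance_bornLaw
  have hg' := hg.hasVariance_bornLaw
  have := hf'.1
  rw [covQ, positionLaw_shearedProduct hf hg, (hf'.prod hg').covariance_map_shear_fst,
    hf'.covariance_prod hg', variance_snd_prod, zero_add]

theorem covP_shearedProduct (hf : IsSystemState f) (hg : IsSystemState g) :
    covP (.pure (shearedProduct r f g)) = r * Var[id; bornLaw (fourierOne f)] := by
  have hf' := hf.hasVariance_bornLaw_fourierOne
  have hg' := hg.hasVariance_bornLaw_fourierOne
  have := hg'.1
  rw [covP, momentumLaw_shearedProduct hf hg, (hf'.prod hg').covariance_map_shear_snd,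
    hf'.covariance_prod hg', variance_fst_prod, zero_add]

theorem shear_focusing_inequalities_iff {t r kap : ℝ} (ht : 0 < t) :
    (0 < (kap - 1) * (r - t * (kap - 1)) ∧ 0 < (kap + 1) * (r - t * (kap + 1))) ↔
      1 < |kap| ∧ 0 < kap * r ∧ t * (1 + |kap|) < |r| := by
  simp only [mul_pos_iff, sub_pos, sub_neg]
  constructor
  · rintro ⟨⟨hlow, _⟩ | ⟨hlow, hr⟩, ⟨hhigh, hr'⟩ | ⟨hhigh, hr'⟩⟩
    · have hκ : 0 < kap := by linarith
      have hr₀ : 0 < r := (mul_pos ht hhigh).trans hr'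
      rw [abs_of_pos hκ, abs_of_pos hr₀, add_comm 1 kap]
      exact ⟨hlow, .inl ⟨hκ, hr₀⟩, hr'⟩
    · linarith
    · linarith [mul_neg_of_pos_of_neg ht (sub_neg.2 hlow), mul_pos ht hhigh]
    · have hκ : kap < 0 := by linarith
      have hr₀ : r < 0 := hr'.trans (mul_neg_of_pos_of_neg ht hhigh)
      rw [abs_of_neg hκ, abs_of_neg hr₀]
      exact ⟨by linarith, .inr ⟨hκ, hr₀⟩, by linarith⟩
  · rintro ⟨hκ, ⟨hκ₀, hr₀⟩ | ⟨hκ₀, hr₀⟩, hr⟩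
    · rw [abs_of_pos hκ₀] at hκ hr
      rw [abs_of_pos hr₀] at hr
      exact ⟨.inl ⟨hκ, by linarith⟩, .inl ⟨by linarith, by linarith⟩⟩
    · rw [abs_of_neg hκ₀] at hκ hr
      rw [abs_of_neg hr₀] at hr
      exact ⟨.inr ⟨by linarith, by linarith⟩, .inr ⟨by linarith, by linarith⟩⟩

theorem jointFocusing_shearedProduct_iff {lam mu kap : ℝ} (hcoupling : 0 < lam * mu)
    (hf : IsSystemState f) (hg : IsSystemState g) {ψ : ℝ → ℂ} (hψ : IsSystemState ψ) :
    JointFocusing lam mu kap (.pure (shearedProduct r f g)) ψ ↔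
      1 < |kap| ∧ 0 < kap * r ∧ lam * mu / 4 * (1 + |kap|) < |r| := by
  have hQ : (1 - kap) * (-r * Var[id; bornLaw g] -
      lam * mu / 4 * (1 - kap) * Var[id; bornLaw g]) =
        Var[id; bornLaw g] * ((kap - 1) * (r - lam * mu / 4 * (kap - 1))) := by ring
  have hP : (1 + kap) * (r * Var[id; bornLaw (fourierOne f)] -
      lam * mu / 4 * (1 + kap) * Var[id; bornLaw (fourierOne f)]) =
        Var[id; bornLaw (fourierOne f)] * ((kap + 1) * (r - lam * mu / 4 * (kap + 1))) := by ring
  rw [jointFocusing_iff (isProbeState_shearedProduct hf hg) hψ hcoupling,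
    covQ_shearedProduct hf hg, covP_shearedProduct hf hg,
    variance_snd_positionLaw_shearedProduct hf hg, variance_fst_momentumLaw_shearedProduct hf hg,
    hQ, hP, mul_pos_iff_of_pos_left (variance_bornLaw_pos hg.hasVariance_bornLaw),
    mul_pos_iff_of_pos_left (variance_bornLaw_pos hf.hasVariance_bornLaw_fourierOne),
    shear_focusing_inequalities_iff (by positivity)]

theorem jointFocusing_shearedProduct_or_neg_iff {lam mu kap : ℝ} (hcoupling : 0 < lam * mu)
    (hf : IsSystemState f) (hg : IsSystemState g) {ψ : ℝ → ℂ} (hψ : IsSystemState ψ) :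
    (JointFocusing lam mu kap (.pure (shearedProduct r f g)) ψ ∨
        JointFocusing lam mu kap (.pure (shearedProduct (-r) f g)) ψ) ↔
      1 < |kap| ∧ lam * mu / 4 * (1 + |kap|) < |r| := by
  rw [jointFocusing_shearedProduct_iff hcoupling hf hg hψ,
    jointFocusing_shearedProduct_iff hcoupling hf hg hψ, abs_neg, mul_neg, neg_pos]
  refine ⟨by rintro (⟨hκ, -, hr⟩ | ⟨hκ, -, hr⟩) <;> exact ⟨hκ, hr⟩, fun ⟨hκ, hr⟩ => ?_⟩
  have hκ₀ : kap ≠ 0 := abs_pos.1 (one_pos.trans hκ)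
  have hr₀ : r ≠ 0 := abs_pos.1 (lt_trans (by positivity) hr)
  exact (mul_ne_zero hκ₀ hr₀).lt_or_gt.elim (fun h => .inr ⟨hκ, h, hr⟩) fun h => .inl ⟨hκ, h, hr⟩

end ShearedProduct

/-- The convex combination of `ν₁` and `ν₂` with weights `p` and `1 - p`, for `0 ≤ p ≤ 1`. -/
noncomputable def mixture {α : Type*} [MeasurableSpace α] (p : ℝ) (ν₁ ν₂ : Measure α) :
    Measure α :=
  ENNReal.ofReal p • ν₁ + ENNReal.ofReal (1 - p) • ν₂

section Mixture

variable {α : Type*} [MeasurableSpace α] {ν₁ ν₂ : Measure α} {p : ℝ}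

theorem isProbabilityMeasure_mixture (hp₀ : 0 ≤ p) (hp₁ : p ≤ 1) [IsProbabilityMeasure ν₁]
    [IsProbabilityMeasure ν₂] : IsProbabilityMeasure (mixture p ν₁ ν₂) := by
  refine ⟨?_⟩
  rw [mixture, Measure.add_apply, Measure.smul_apply, Measure.smul_apply, measure_univ,
    measure_univ, smul_eq_mul, smul_eq_mul, mul_one, mul_one,
    ← ENNReal.ofReal_add hp₀ (sub_nonneg.2 hp₁), add_sub_cancel, ENNReal.ofReal_one]

theorem memLp_two_mixture {X : α → ℝ} (h₁ : MemLp X 2 ν₁) (h₂ : MemLp X 2 ν₂) :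
    MemLp X 2 (mixture p ν₁ ν₂) := by
  have h₁' : MemLp X 2 (ENNReal.ofReal p • ν₁) := h₁.smul_measure ENNReal.ofReal_ne_top
  have h₂' : MemLp X 2 (ENNReal.ofReal (1 - p) • ν₂) := h₂.smul_measure ENNReal.ofReal_ne_top
  have hX : AEStronglyMeasurable X (mixture p ν₁ ν₂) := h₁'.1.add_measure h₂'.1
  exact (memLp_two_iff_integrable_sq hX).2 (h₁'.integrable_sq.add_measure h₂'.integrable_sq)

theorem integral_mixture (hp₀ : 0 ≤ p) (hp₁ : p ≤ 1) {X : α → ℝ} (h₁ : Integrable X ν₁)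
    (h₂ : Integrable X ν₂) :
    ∫ a, X a ∂mixture p ν₁ ν₂ = p * ∫ a, X a ∂ν₁ + (1 - p) * ∫ a, X a ∂ν₂ := by
  rw [mixture, integral_add_measure (h₁.smul_measure ENNReal.ofReal_ne_top)
    (h₂.smul_measure ENNReal.ofReal_ne_top), integral_smul_measure, integral_smul_measure,
    ENNReal.toReal_ofReal hp₀, ENNReal.toReal_ofReal (sub_nonneg.2 hp₁), smul_eq_mul, smul_eq_mul]

theorem covariance_mixture (hp₀ : 0 ≤ p) (hp₁ : p ≤ 1) [IsProbabilityMeasure ν₁]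
    [IsProbabilityMeasure ν₂] {X Y : α → ℝ} (hX₁ : MemLp X 2 ν₁) (hX₂ : MemLp X 2 ν₂)
    (hY₁ : MemLp Y 2 ν₁) (hY₂ : MemLp Y 2 ν₂) :
    cov[X, Y; mixture p ν₁ ν₂] = p * cov[X, Y; ν₁] + (1 - p) * cov[X, Y; ν₂] +
      (p - p ^ 2) * ((∫ a, X a ∂ν₁) - ∫ a, X a ∂ν₂) * ((∫ a, Y a ∂ν₁) - ∫ a, Y a ∂ν₂) := by
  have := isProbabilityMeasure_mixture hp₀ hp₁ (ν₁ := ν₁) (ν₂ := ν₂)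
  rw [covariance_eq_sub (memLp_two_mixture hX₁ hX₂) (memLp_two_mixture hY₁ hY₂),
    covariance_eq_sub hX₁ hY₁, covariance_eq_sub hX₂ hY₂,
    integral_mixture hp₀ hp₁ (hX₁.integrable one_le_two) (hX₂.integrable one_le_two),
    integral_mixture hp₀ hp₁ (hY₁.integrable one_le_two) (hY₂.integrable one_le_two),
    integral_mixture hp₀ hp₁ (hX₁.integrable_mul hY₁) (hX₂.integrable_mul hY₂)]
  ring

theorem variance_mixture (hp₀ : 0 ≤ p) (hp₁ : p ≤ 1) [IsProbabilityMeasure ν₁]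
    [IsProbabilityMeasure ν₂] {X : α → ℝ} (h₁ : MemLp X 2 ν₁) (h₂ : MemLp X 2 ν₂) :
    Var[X; mixture p ν₁ ν₂] = p * Var[X; ν₁] + (1 - p) * Var[X; ν₂] +
      (p - p ^ 2) * ((∫ a, X a ∂ν₁) - ∫ a, X a ∂ν₂) ^ 2 := by
  rw [← covariance_self (memLp_two_mixture h₁ h₂).aemeasurable,
    covariance_mixture hp₀ hp₁ h₁ h₂ h₁ h₂, covariance_self h₁.aemeasurable,
    covariance_self h₂.aemeasurable]
  ring

theorem HasSecondMoments.mixture {ν₁ ν₂ : Measure (ℝ × ℝ)} (hp₀ : 0 ≤ p) (hp₁ : p ≤ 1)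
    (h₁ : HasSecondMoments ν₁) (h₂ : HasSecondMoments ν₂) :
    HasSecondMoments (mixture p ν₁ ν₂) := by
  have := h₁.isProbabilityMeasure
  have := h₂.isProbabilityMeasure
  exact ⟨isProbabilityMeasure_mixture hp₀ hp₁, memLp_two_mixture h₁.memLp_fst h₂.memLp_fst,
    memLp_two_mixture h₁.memLp_snd h₂.memLp_snd⟩

end Mixture

theorem positionLaw_mix (p : ℝ) (φ₁ φ₂ : ℝ × ℝ → ℂ) : positionLaw (.mix p φ₁ φ₂) =
    mixture p (positionLaw (.pure φ₁)) (positionLaw (.pure φ₂)) := by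
  rw [mixture, positionLaw_pure, positionLaw_pure]
  exact Fin.sum_univ_two fun i : Fin 2 =>
    ENNReal.ofReal (![p, 1 - p] i) • bornLaw ((![φ₁, φ₂] : Fin 2 → ℝ × ℝ → ℂ) i)

theorem momentumLaw_mix (p : ℝ) (φ₁ φ₂ : ℝ × ℝ → ℂ) : momentumLaw (.mix p φ₁ φ₂) =
    mixture p (momentumLaw (.pure φ₁)) (momentumLaw (.pure φ₂)) := by
  rw [mixture, momentumLaw_pure, momentumLaw_pure]
  exact Fin.sum_univ_two fun i : Fin 2 =>
    ENNReal.ofReal (![p, 1 - p] i) • bornLaw (fourierTwo ((![φ₁, φ₂] : Fin 2 → ℝ × ℝ → ℂ) i))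

theorem IsProbeState.mix {p : ℝ} {φ₁ φ₂ : ℝ × ℝ → ℂ} (hp₀ : 0 ≤ p) (hp₁ : p ≤ 1)
    (h₁ : IsProbeState (.pure φ₁)) (h₂ : IsProbeState (.pure φ₂)) :
    IsProbeState (.mix p φ₁ φ₂) where
  integrable i := by
    change Fin 2 at i
    fin_cases i
    · exact h₁.integrable (0 : Fin 1)
    · exact h₂.integrable (0 : Fin 1)
  memLp i := by
    change Fin 2 at i
    fin_cases i
    · exact h₁.memLp (0 : Fin 1)
    · exact h₂.memLp (0 : Fin 1)
  position := positionLaw_mix p φ₁ φ₂ ▸ h₁.position.mixture hp₀ hp₁ h₂.position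
  momentum := momentumLaw_mix p φ₁ φ₂ ▸ h₁.momentum.mixture hp₀ hp₁ h₂.momentum

/-- `φ` is a pure probe state in which the two probes are uncorrelated, both in position and in
momentum, and centred on the same phase space point `(x, k)`. Of the four variances only the two
that enter the focusing criterion, of `Q₂` and of `P₁`, are prescribed. -/
structure IsUncorrelatedProbe (x k S R : ℝ) (φ : ℝ × ℝ → ℂ) : Prop where
  isProbeState : IsProbeState (.pure φ)
  covQ_eq_zero : covQ (.pure φ) = 0
  covP_eq_zero : covP (.pure φ) = 0
  mean_Q₁ : ∫ z, z.1 ∂(positionLaw (.pure φ)) = x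
  mean_Q₂ : ∫ z, z.2 ∂(positionLaw (.pure φ)) = x
  mean_P₁ : ∫ z, z.1 ∂(momentumLaw (.pure φ)) = k
  mean_P₂ : ∫ z, z.2 ∂(momentumLaw (.pure φ)) = k
  var_Q₂ : Var[Prod.snd; positionLaw (.pure φ)] = S
  var_P₁ : Var[Prod.fst; momentumLaw (.pure φ)] = R

namespace IsUncorrelatedProbe

theorem S_nonneg {x k S R : ℝ} {φ : ℝ × ℝ → ℂ} (h : IsUncorrelatedProbe x k S R φ) : 0 ≤ S :=
  h.var_Q₂ ▸ variance_nonneg _ _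

theorem R_nonneg {x k S R : ℝ} {φ : ℝ × ℝ → ℂ} (h : IsUncorrelatedProbe x k S R φ) : 0 ≤ R :=
  h.var_P₁ ▸ variance_nonneg _ _

variable {p x₁ k₁ x₂ k₂ S R : ℝ} {φ₁ φ₂ : ℝ × ℝ → ℂ} (hp₀ : 0 ≤ p) (hp₁ : p ≤ 1)
  (h₁ : IsUncorrelatedProbe x₁ k₁ S R φ₁) (h₂ : IsUncorrelatedProbe x₂ k₂ S R φ₂)
include hp₀ hp₁ h₁ h₂

theorem isProbeState_mix : IsProbeState (.mix p φ₁ φ₂) :=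
  h₁.isProbeState.mix hp₀ hp₁ h₂.isProbeState

theorem covQ_mix : covQ (.mix p φ₁ φ₂) = (p - p ^ 2) * (x₁ - x₂) ^ 2 := by
  obtain ⟨_, hfst₁, hsnd₁⟩ := h₁.isProbeState.position
  obtain ⟨_, hfst₂, hsnd₂⟩ := h₂.isProbeState.position
  rw [covQ, positionLaw_mix, covariance_mixture hp₀ hp₁ hfst₁ hfst₂ hsnd₁ hsnd₂, ← covQ, ← covQ,
    h₁.covQ_eq_zero, h₂.covQ_eq_zero, h₁.mean_Q₁, h₁.mean_Q₂, h₂.mean_Q₁, h₂.mean_Q₂]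
  ring

theorem covP_mix : covP (.mix p φ₁ φ₂) = (p - p ^ 2) * (k₁ - k₂) ^ 2 := by
  obtain ⟨_, hfst₁, hsnd₁⟩ := h₁.isProbeState.momentum
  obtain ⟨_, hfst₂, hsnd₂⟩ := h₂.isProbeState.momentum
  rw [covP, momentumLaw_mix, covariance_mixture hp₀ hp₁ hfst₁ hfst₂ hsnd₁ hsnd₂, ← covP, ← covP,
    h₁.covP_eq_zero, h₂.covP_eq_zero, h₁.mean_P₁, h₁.mean_P₂, h₂.mean_P₁, h₂.mean_P₂]
  ring

theorem variance_snd_positionLaw_mix :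
    Var[Prod.snd; positionLaw (.mix p φ₁ φ₂)] = S + covQ (.mix p φ₁ φ₂) := by
  obtain ⟨_, -, hsnd₁⟩ := h₁.isProbeState.position
  obtain ⟨_, -, hsnd₂⟩ := h₂.isProbeState.position
  rw [covQ_mix hp₀ hp₁ h₁ h₂, positionLaw_mix, variance_mixture hp₀ hp₁ hsnd₁ hsnd₂, h₁.var_Q₂,
    h₂.var_Q₂, h₁.mean_Q₂, h₂.mean_Q₂]
  ring

theorem variance_fst_momentumLaw_mix :
    Var[Prod.fst; momentumLaw (.mix p φ₁ φ₂)] = R + covP (.mix p φ₁ φ₂) := by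
  obtain ⟨_, hfst₁, -⟩ := h₁.isProbeState.momentum
  obtain ⟨_, hfst₂, -⟩ := h₂.isProbeState.momentum
  rw [covP_mix hp₀ hp₁ h₁ h₂, momentumLaw_mix, variance_mixture hp₀ hp₁ hfst₁ hfst₂, h₁.var_P₁,
    h₂.var_P₁, h₁.mean_P₁, h₂.mean_P₁]
  ring

end IsUncorrelatedProbe

theorem pos_of_mul_sub_pos {t u V C : ℝ} (ht : 0 ≤ t) (hV : 0 ≤ V) (hC : 0 ≤ C)
    (h : 0 < u * (C - t * u * (V + C))) : 0 < u := by
  by_contra! hu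
  have hnoise : t * u * (V + C) ≤ 0 :=
    mul_nonpos_of_nonpos_of_nonneg (mul_nonpos_of_nonneg_of_nonpos ht hu) (add_nonneg hV hC)
  exact h.not_ge (mul_nonpos_of_nonpos_of_nonneg hu (by linarith))

theorem mul_sub_pos_of_div_lt {t u V C : ℝ} (hu : 0 < u) (htu : t * u < 1)
    (hC : t * u * V / (1 - t * u) < C) : 0 < u * (C - t * u * (V + C)) := by
  rw [div_lt_iff₀ (sub_pos.2 htu)] at hC
  exact mul_pos hu (by linarith)

/-- A covariance beyond which the mixtures of uncorrelated probe states with variances `S` of `Q₂`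
and `R` of `P₁` are jointly focusing. With `t = λμ/4 (1 + |κ|) < 1`, a covariance `C` compensates
the noise `t * (V + C)` as soon as `t * V < (1 - t) * C`. -/
noncomputable def focusingThreshold (lam mu kap S R : ℝ) : ℝ :=
  (S + R + 1) / (1 - lam * mu / 4 * (1 + |kap|))

section Mixtures

variable {lam mu kap p x₁ k₁ x₂ k₂ S R : ℝ} {φ₁ φ₂ : ℝ × ℝ → ℂ} {ψ : ℝ → ℂ}

theorem jointFocusing_mix_iff (hcoupling : 0 < lam * mu) (hp₀ : 0 ≤ p) (hp₁ : p ≤ 1)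
    (h₁ : IsUncorrelatedProbe x₁ k₁ S R φ₁) (h₂ : IsUncorrelatedProbe x₂ k₂ S R φ₂)
    (hψ : IsSystemState ψ) :
    JointFocusing lam mu kap (.mix p φ₁ φ₂) ψ ↔
      0 < (1 - kap) * (covQ (.mix p φ₁ φ₂) -
        lam * mu / 4 * (1 - kap) * (S + covQ (.mix p φ₁ φ₂))) ∧
      0 < (1 + kap) * (covP (.mix p φ₁ φ₂) -
        lam * mu / 4 * (1 + kap) * (R + covP (.mix p φ₁ φ₂))) := by
  rw [jointFocusing_iff (h₁.isProbeState_mix hp₀ hp₁ h₂) hψ hcoupling,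
    h₁.variance_snd_positionLaw_mix hp₀ hp₁ h₂, h₁.variance_fst_momentumLaw_mix hp₀ hp₁ h₂]

theorem abs_lt_one_of_jointFocusing_mix (hcoupling : 0 < lam * mu) (hp₀ : 0 ≤ p) (hp₁ : p ≤ 1)
    (h₁ : IsUncorrelatedProbe x₁ k₁ S R φ₁) (h₂ : IsUncorrelatedProbe x₂ k₂ S R φ₂)
    (hψ : IsSystemState ψ) (h : JointFocusing lam mu kap (.mix p φ₁ φ₂) ψ) : |kap| < 1 := by
  have hp : 0 ≤ p - p ^ 2 := by nlinarith
  have hQ : 0 ≤ covQ (.mix p φ₁ φ₂) := by rw [h₁.covQ_mix hp₀ hp₁ h₂]; positivity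
  have hP : 0 ≤ covP (.mix p φ₁ φ₂) := by rw [h₁.covP_mix hp₀ hp₁ h₂]; positivity
  obtain ⟨hfocusQ, hfocusP⟩ := (jointFocusing_mix_iff hcoupling hp₀ hp₁ h₁ h₂ hψ).1 h
  have hκ : 0 < 1 - kap := pos_of_mul_sub_pos (by positivity) h₁.S_nonneg hQ hfocusQ
  have hκ' : 0 < 1 + kap := pos_of_mul_sub_pos (by positivity) h₁.R_nonneg hP hfocusP
  exact abs_lt.2 ⟨by linarith, by linarith⟩

theorem jointFocusing_mix_of_focusingThreshold_le (hcoupling : 0 < lam * mu) (hkap : |kap| < 1)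
    (hweak : lam * mu / 4 * (1 + |kap|) < 1) (hp₀ : 0 ≤ p) (hp₁ : p ≤ 1)
    (h₁ : IsUncorrelatedProbe x₁ k₁ S R φ₁) (h₂ : IsUncorrelatedProbe x₂ k₂ S R φ₂)
    (hQ : focusingThreshold lam mu kap S R ≤ covQ (.mix p φ₁ φ₂))
    (hP : focusingThreshold lam mu kap S R ≤ covP (.mix p φ₁ φ₂)) (hψ : IsSystemState ψ) :
    JointFocusing lam mu kap (.mix p φ₁ φ₂) ψ := by
  have hS := h₁.S_nonneg
  have hR := h₁.R_nonneg
  obtain ⟨hlow, hhigh⟩ := abs_lt.1 hkap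
  have hstrength {u : ℝ} (hu : u ≤ 1 + |kap|) :
      lam * mu / 4 * u ≤ lam * mu / 4 * (1 + |kap|) := by gcongr
  have hthreshold {u V : ℝ} (hu : u ≤ 1 + |kap|) (hV₀ : 0 ≤ V) (hV : V < S + R + 1) :
      lam * mu / 4 * u * V / (1 - lam * mu / 4 * u) < focusingThreshold lam mu kap S R := by
    refine div_lt_div₀ ?_ (sub_le_sub_left (hstrength hu) 1) (by positivity) (sub_pos.2 hweak)
    exact (mul_le_of_le_one_left hV₀ ((hstrength hu).trans hweak.le)).trans_lt hV
  have hκ : 1 - kap ≤ 1 + |kap| := by linarith [neg_le_abs kap]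
  have hκ' : 1 + kap ≤ 1 + |kap| := by linarith [le_abs_self kap]
  exact (jointFocusing_mix_iff hcoupling hp₀ hp₁ h₁ h₂ hψ).2
    ⟨mul_sub_pos_of_div_lt (by linarith) ((hstrength hκ).trans_lt hweak)
      ((hthreshold hκ hS (by linarith)).trans_le hQ),
    mul_sub_pos_of_div_lt (by linarith) ((hstrength hκ').trans_lt hweak)
      ((hthreshold hκ' hR (by linarith)).trans_le hP)⟩

theorem jointFocusing_mix_of_sqrt_le (hcoupling : 0 < lam * mu) (hkap : |kap| < 1)
    (hweak : lam * mu / 4 * (1 + |kap|) < 1) (hp₀ : 0 < p) (hp₁ : p < 1)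
    (h₁ : IsUncorrelatedProbe x₁ k₁ S R φ₁) (h₂ : IsUncorrelatedProbe x₂ k₂ S R φ₂)
    (hx : √(focusingThreshold lam mu kap S R / (p - p ^ 2)) ≤ |x₁ - x₂|)
    (hk : √(focusingThreshold lam mu kap S R / (p - p ^ 2)) ≤ |k₁ - k₂|) (hψ : IsSystemState ψ) :
    JointFocusing lam mu kap (.mix p φ₁ φ₂) ψ := by
  have hp : 0 < p - p ^ 2 := by nlinarith
  have hlarge {s : ℝ} (hs : √(focusingThreshold lam mu kap S R / (p - p ^ 2)) ≤ |s|) :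
      focusingThreshold lam mu kap S R ≤ (p - p ^ 2) * s ^ 2 := by
    rw [← div_le_iff₀' hp, ← sq_abs s]
    exact (Real.sqrt_le_left (abs_nonneg s)).1 hs
  exact jointFocusing_mix_of_focusingThreshold_le hcoupling hkap hweak hp₀.le hp₁.le h₁ h₂
    (h₁.covQ_mix hp₀.le hp₁.le h₂ ▸ hlarge hx) (h₁.covP_mix hp₀.le hp₁.le h₂ ▸ hlarge hk) hψ

end Mixtures

theorem integrable_sq_mul_exp_neg_mul_sub_sq {a : ℝ} (ha : 0 < a) (m : ℝ) :
    Integrable fun q : ℝ => q ^ 2 * Real.exp (-a * (q - m) ^ 2) := by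
  have hsq : Integrable fun q : ℝ => q ^ 2 * Real.exp (-a * q ^ 2) := by
    simpa using integrable_rpow_mul_exp_neg_mul_sq ha (s := 2) (by norm_num)
  have hexpand := ((hsq.add ((integrable_mul_exp_neg_mul_sq ha).const_mul (2 * m))).add
    ((integrable_exp_neg_mul_sq ha).const_mul (m ^ 2))).comp_sub_right m
  refine hexpand.congr (ae_of_all _ fun q => ?_)
  simp only [Pi.add_apply]
  ring

section GaussianWaves

variable {A : ℂ} (hA : 0 < A.re) (B C : ℂ)
include hA

theorem norm_cexp_quadratic_sq (q : ℝ) :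
    ‖Complex.exp (-A * (q : ℂ) ^ 2 + B * q + C)‖ ^ 2 =
      Real.exp (2 * C.re + B.re ^ 2 / (2 * A.re)) *
        Real.exp (-(2 * A.re) * (q - B.re / (2 * A.re)) ^ 2) := by
  have hre : (-A * (q : ℂ) ^ 2 + B * q + C).re = -A.re * q ^ 2 + B.re * q + C.re := by
    rw [← Complex.ofReal_pow, Complex.add_re, Complex.add_re, Complex.re_mul_ofReal,
      Complex.re_mul_ofReal, Complex.neg_re]
  rw [Complex.norm_exp, hre, ← Real.exp_nat_mul, ← Real.exp_add]
  congr 1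
  push_cast
  field_simp
  ring

theorem memLp_two_cexp_quadratic :
    MemLp (fun q : ℝ => Complex.exp (-A * (q : ℂ) ^ 2 + B * q + C)) 2 := by
  have hcont : Continuous fun q : ℝ => Complex.exp (-A * (q : ℂ) ^ 2 + B * q + C) := by fun_prop
  rw [memLp_two_iff_integrable_sq_norm hcont.aestronglyMeasurable]
  simp only [norm_cexp_quadratic_sq hA]
  exact ((integrable_exp_neg_mul_sq (by positivity)).comp_sub_right _).const_mul _

theorem integrable_sq_mul_norm_cexp_quadratic_sq :
    Integrable fun q : ℝ => q ^ 2 * ‖Complex.exp (-A * (q : ℂ) ^ 2 + B * q + C)‖ ^ 2 := by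
  simp only [norm_cexp_quadratic_sq hA]
  exact ((integrable_sq_mul_exp_neg_mul_sub_sq (by positivity) _).const_mul _).congr
    (ae_of_all _ fun _ => mul_left_comm _ _ _)

theorem fourierOne_cexp_quadratic (p : ℝ) :
    fourierOne (fun q => Complex.exp (-A * (q : ℂ) ^ 2 + B * q + C)) p =
      ((√(2 * Real.pi))⁻¹ : ℝ) * (Real.pi / A) ^ (1 / 2 : ℂ) *
        Complex.exp (-(1 / (4 * A)) * (p : ℂ) ^ 2 + -(Complex.I * B / (2 * A)) * p +
          (C + B ^ 2 / (4 * A))) := by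
  have hA₀ : A ≠ 0 := fun h => by simp [h] at hA
  have hintegral := integral_cexp_quadratic (b := -A) (by simpa using hA) (B - Complex.I * p) C
  rw [neg_neg] at hintegral
  rw [fourierOne, mul_assoc]
  congr 1
  convert hintegral using 3
  · rw [← Complex.exp_add]
    congr 1
    push_cast
    ring
  · field_simp
    linear_combination -2 * (p : ℂ) ^ 2 * Complex.I_sq

theorem re_one_div_four_mul_pos : 0 < (1 / (4 * A)).re := by
  have hA₀ : A ≠ 0 := fun h => by simp [h] at hA
  have hnormSq := Complex.normSq_pos.2 hA₀
  have : 1 / (4 * A) = ((1 / 4 : ℝ) : ℂ) * A⁻¹ := by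
    push_cast
    field_simp
  rw [this, Complex.re_ofReal_mul, Complex.inv_re]
  positivity

end GaussianWaves

theorem IsGaussianWave.isSystemState {f : ℝ → ℂ} (hf : IsGaussianWave f) : IsSystemState f := by
  obtain ⟨⟨A, B, C, hA, hf⟩, hnorm⟩ := hf
  obtain rfl : f = fun q : ℝ => Complex.exp (-A * (q : ℂ) ^ 2 + B * q + C) := funext hf
  refine ⟨memLp_two_cexp_quadratic hA B C, hnorm, integrable_sq_mul_norm_cexp_quadratic_sq hA B C,
    ?_⟩
  simp only [fourierOne_cexp_quadratic hA, norm_mul _ (Complex.exp _), mul_pow]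
  exact ((integrable_sq_mul_norm_cexp_quadratic_sq (re_one_div_four_mul_pos hA) _ _).const_mul
    _).congr (ae_of_all _ fun _ => mul_left_comm _ _ _)

/-- The real normalised Gaussian wave function `(2α/π)^{1/4} exp(-α q²)`, for `α > 0`. -/
noncomputable def centeredGaussian (α q : ℝ) : ℂ :=
  ((2 * α / Real.pi) ^ (1 / 4 : ℝ) * Real.exp (-α * q ^ 2) : ℝ)

theorem isGaussianWave_centeredGaussian {α : ℝ} (hα : 0 < α) :
    IsGaussianWave (centeredGaussian α) := by
  have hnorm (q : ℝ) :
      ‖centeredGaussian α q‖ ^ 2 = √(2 * α / Real.pi) * Real.exp (-(2 * α) * q ^ 2) := by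
    rw [centeredGaussian, Complex.norm_real, Real.norm_of_nonneg (by positivity), mul_pow,
      ← Real.rpow_natCast, ← Real.rpow_mul (by positivity), ← Real.exp_nat_mul, Real.sqrt_eq_rpow]
    norm_num [mul_assoc]
  refine ⟨⟨α, 0, Real.log ((2 * α / Real.pi) ^ (1 / 4 : ℝ)), by simpa using hα, fun q => ?_⟩, ?_⟩
  · rw [centeredGaussian, zero_mul, add_zero, Complex.exp_add, ← Complex.ofReal_exp,
      Real.exp_log (by positivity)]
    push_cast
    exact mul_comm _ _
  · simp only [hnorm]
    rw [integral_const_mul, integral_gaussian, ← Real.sqrt_mul (by positivity),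
      div_mul_div_cancel₀ Real.pi_ne_zero, div_self (by positivity), Real.sqrt_one]

theorem twoModeGaussian_eq_shearedProduct {a b d : ℝ} (ha : 0 < a) (hdet : 0 < a * d - b * b) :
    twoModeGaussian !![a, b; b, d] = shearedProduct (b / a) (centeredGaussian a)
      (centeredGaussian ((a * d - b * b) / a)) := by
  funext z
  have hconst : (4 * (a * d - b * b) / Real.pi ^ 2) ^ (1 / 4 : ℝ) =
      (2 * a / Real.pi) ^ (1 / 4 : ℝ) * (2 * ((a * d - b * b) / a) / Real.pi) ^ (1 / 4 : ℝ) := by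
    rw [← Real.mul_rpow (by positivity) (by positivity)]
    congr 1
    field_simp
    ring
  have hsquare : -(![z.1, z.2] ⬝ᵥ Matrix.mulVec !![a, b; b, d] ![z.1, z.2]) =
      -a * (z.1 + b / a * z.2) ^ 2 + -((a * d - b * b) / a) * z.2 ^ 2 := by
    have hquadratic : ![z.1, z.2] ⬝ᵥ Matrix.mulVec !![a, b; b, d] ![z.1, z.2] =
        z.1 * (a * z.1 + b * z.2) + z.2 * (b * z.1 + d * z.2) := by
      simp [Matrix.mulVec_eq_sum, dotProduct, Fin.sum_univ_two, mul_comm]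
    rw [hquadratic]
    field_simp
    ring
  rw [twoModeGaussian, Matrix.det_fin_two_of, hconst, hsquare, Real.exp_add, mul_mul_mul_comm,
    Complex.ofReal_mul]
  rfl

theorem twoModeGaussian_neg_eq_shearedProduct {a b d : ℝ} (ha : 0 < a)
    (hdet : 0 < a * d - b * b) :
    twoModeGaussian !![a, -b; -b, d] = shearedProduct (-(b / a)) (centeredGaussian a)
      (centeredGaussian ((a * d - b * b) / a)) := by
  simpa only [neg_div, neg_mul_neg] using
    twoModeGaussian_eq_shearedProduct (b := -b) ha (by rwa [neg_mul_neg])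

theorem IsGaussianProduct.isUncorrelatedProbe {x k S R : ℝ} {φ : ℝ × ℝ → ℂ}
    (h : IsGaussianProduct x k S R φ) : IsUncorrelatedProbe x k S R φ := by
  obtain ⟨f, g, hf, hg, hφ⟩ := h.product
  obtain rfl : φ = shearedProduct 0 f g := funext fun z => by simp [hφ, shearedProduct]
  have hf := hf.isSystemState
  have hg := hg.isSystemState
  exact ⟨isProbeState_shearedProduct hf hg, by simp [covQ_shearedProduct hf hg],
    by simp [covP_shearedProduct hf hg], h.mean_Q₁, h.mean_Q₂, h.mean_P₁, h.mean_P₂, h.var_Q₂,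
    h.var_P₁⟩

theorem mainTheorem4_general {lam mu kap : ℝ} (hcoupling : 0 < lam * mu) :
    (∀ (r : ℝ) (f g ψ : ℝ → ℂ), IsSystemState f → IsSystemState g → IsSystemState ψ →
      FocusDefined lam mu kap (.pure (shearedProduct r f g)) ψ ∧
      (JointFocusing lam mu kap (.pure (shearedProduct r f g)) ψ ↔
        1 < |kap| ∧ 0 < kap * r ∧ lam * mu / 4 * (1 + |kap|) < |r|) ∧
      ((JointFocusing lam mu kap (.pure (shearedProduct r f g)) ψ ∨
          JointFocusing lam mu kap (.pure (shearedProduct (-r) f g)) ψ) ↔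
        1 < |kap| ∧ lam * mu / 4 * (1 + |kap|) < |r|)) ∧
    (∀ p x₁ k₁ x₂ k₂ S R : ℝ, 0 ≤ p → p ≤ 1 → ∀ φ₁ φ₂ : ℝ × ℝ → ℂ,
      IsUncorrelatedProbe x₁ k₁ S R φ₁ → IsUncorrelatedProbe x₂ k₂ S R φ₂ →
        covQ (.mix p φ₁ φ₂) = (p - p ^ 2) * (x₁ - x₂) ^ 2 ∧
        covP (.mix p φ₁ φ₂) = (p - p ^ 2) * (k₁ - k₂) ^ 2 ∧
        ∀ ψ : ℝ → ℂ, IsSystemState ψ →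
          FocusDefined lam mu kap (.mix p φ₁ φ₂) ψ ∧
          (JointFocusing lam mu kap (.mix p φ₁ φ₂) ψ → |kap| < 1)) ∧
    (|kap| < 1 → lam * mu / 4 * (1 + |kap|) < 1 → ∀ S R : ℝ, ∃ C : ℝ,
      ∀ p x₁ k₁ x₂ k₂ : ℝ, 0 ≤ p → p ≤ 1 → ∀ φ₁ φ₂ : ℝ × ℝ → ℂ,
        IsUncorrelatedProbe x₁ k₁ S R φ₁ → IsUncorrelatedProbe x₂ k₂ S R φ₂ →
          C ≤ covQ (.mix p φ₁ φ₂) → C ≤ covP (.mix p φ₁ φ₂) →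
            ∀ ψ : ℝ → ℂ, IsSystemState ψ → JointFocusing lam mu kap (.mix p φ₁ φ₂) ψ) ∧
    (|kap| < 1 → lam * mu / 4 * (1 + |kap|) < 1 → ∀ S R p : ℝ, 0 < p → p < 1 → ∃ L : ℝ,
      ∀ x₁ k₁ x₂ k₂ : ℝ, ∀ φ₁ φ₂ : ℝ × ℝ → ℂ,
        IsUncorrelatedProbe x₁ k₁ S R φ₁ → IsUncorrelatedProbe x₂ k₂ S R φ₂ →
          L ≤ |x₁ - x₂| → L ≤ |k₁ - k₂| →
            ∀ ψ : ℝ → ℂ, IsSystemState ψ → JointFocusing lam mu kap (.mix p φ₁ φ₂) ψ) := by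
  have hlam : lam ≠ 0 := left_ne_zero_of_mul hcoupling.ne'
  have hmu : mu ≠ 0 := right_ne_zero_of_mul hcoupling.ne'
  refine ⟨fun r f g ψ hf hg hψ => ⟨focusDefined (isProbeState_shearedProduct hf hg) hψ hlam hmu,
      jointFocusing_shearedProduct_iff hcoupling hf hg hψ,
      jointFocusing_shearedProduct_or_neg_iff hcoupling hf hg hψ⟩,
    fun p x₁ k₁ x₂ k₂ S R hp₀ hp₁ φ₁ φ₂ h₁ h₂ =>
      ⟨h₁.covQ_mix hp₀ hp₁ h₂, h₁.covP_mix hp₀ hp₁ h₂, fun ψ hψ =>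
        ⟨focusDefined (h₁.isProbeState_mix hp₀ hp₁ h₂) hψ hlam hmu,
          abs_lt_one_of_jointFocusing_mix hcoupling hp₀ hp₁ h₁ h₂ hψ⟩⟩,
    fun hkap hweak S R => ⟨focusingThreshold lam mu kap S R,
      fun p x₁ k₁ x₂ k₂ hp₀ hp₁ φ₁ φ₂ h₁ h₂ hQ hP ψ =>
        jointFocusing_mix_of_focusingThreshold_le hcoupling hkap hweak hp₀ hp₁ h₁ h₂ hQ hP⟩,
    fun hkap hweak S R p hp₀ hp₁ => ⟨√(focusingThreshold lam mu kap S R / (p - p ^ 2)),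
      fun x₁ k₁ x₂ k₂ φ₁ φ₂ h₁ h₂ hx hk ψ =>
        jointFocusing_mix_of_sqrt_le hcoupling hkap hweak hp₀ hp₁ h₁ h₂ hx hk⟩⟩

end ArthursKelly

open ArthursKelly in
theorem mainTheorem4 (lam mu kap : ℝ) (hlam : 0 < lam) (hmu : 0 < mu) :
    -- two-mode Gaussian state
    (∀ a b d : ℝ, (!![a, b; b, d] : Matrix (Fin 2) (Fin 2) ℝ).PosDef →
      ∀ ψ : ℝ → ℂ, IsSystemState ψ →
        FocusDefined lam mu kap (.pure (twoModeGaussian !![a, b; b, d])) ψ ∧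
        (JointFocusing lam mu kap (.pure (twoModeGaussian !![a, b; b, d])) ψ ↔
          1 < |kap| ∧ 0 < kap * b ∧ lam * mu / 4 * (1 + |kap|) < |b| / a) ∧
        ((JointFocusing lam mu kap (.pure (twoModeGaussian !![a, b; b, d])) ψ ∨
            JointFocusing lam mu kap (.pure (twoModeGaussian !![a, -b; -b, d])) ψ) ↔
          1 < |kap| ∧ lam * mu / 4 * (1 + |kap|) < |b| / a)) ∧
    -- separable mixture: covariances, and necessity of `|κ| < 1`
    (∀ p x₁ k₁ x₂ k₂ S R : ℝ, 0 < p → p < 1 → ∀ φ₁ φ₂ : ℝ × ℝ → ℂ,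
      IsGaussianProduct x₁ k₁ S R φ₁ → IsGaussianProduct x₂ k₂ S R φ₂ →
        covQ (.mix p φ₁ φ₂) = (p - p ^ 2) * (x₁ - x₂) ^ 2 ∧
        covP (.mix p φ₁ φ₂) = (p - p ^ 2) * (k₁ - k₂) ^ 2 ∧
        ∀ ψ : ℝ → ℂ, IsSystemState ψ →
          FocusDefined lam mu kap (.mix p φ₁ φ₂) ψ ∧
          (JointFocusing lam mu kap (.mix p φ₁ φ₂) ψ → |kap| < 1)) ∧
    -- separable mixture: joint focusing at large covariances
    (|kap| < 1 → lam * mu / 4 * (1 + |kap|) < 1 → ∀ S R : ℝ, ∃ C : ℝ,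
      ∀ p x₁ k₁ x₂ k₂ : ℝ, 0 < p → p < 1 → ∀ φ₁ φ₂ : ℝ × ℝ → ℂ,
        IsGaussianProduct x₁ k₁ S R φ₁ → IsGaussianProduct x₂ k₂ S R φ₂ →
          C ≤ covQ (.mix p φ₁ φ₂) → C ≤ covP (.mix p φ₁ φ₂) →
            ∀ ψ : ℝ → ℂ, IsSystemState ψ → JointFocusing lam mu kap (.mix p φ₁ φ₂) ψ) ∧
    -- separable mixture: joint focusing at large separation in phase space
    (|kap| < 1 → lam * mu / 4 * (1 + |kap|) < 1 → ∀ S R p : ℝ, 0 < p → p < 1 → ∃ L : ℝ,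
      ∀ x₁ k₁ x₂ k₂ : ℝ, ∀ φ₁ φ₂ : ℝ × ℝ → ℂ,
        IsGaussianProduct x₁ k₁ S R φ₁ → IsGaussianProduct x₂ k₂ S R φ₂ →
          L ≤ |x₁ - x₂| → L ≤ |k₁ - k₂| →
            ∀ ψ : ℝ → ℂ, IsSystemState ψ → JointFocusing lam mu kap (.mix p φ₁ φ₂) ψ) := by
  obtain ⟨hsheared, hcovariances, hlarge, hseparated⟩ :=
    mainTheorem4_general (kap := kap) (mul_pos hlam hmu)
  refine ⟨fun a b d hD ψ hψ => ?_, fun p x₁ k₁ x₂ k₂ S R hp₀ hp₁ φ₁ φ₂ h₁ h₂ =>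
      hcovariances p x₁ k₁ x₂ k₂ S R hp₀.le hp₁.le φ₁ φ₂ h₁.isUncorrelatedProbe
        h₂.isUncorrelatedProbe,
    fun hkap hweak S R => (hlarge hkap hweak S R).imp
      fun C hC p x₁ k₁ x₂ k₂ hp₀ hp₁ φ₁ φ₂ h₁ h₂ =>
        hC p x₁ k₁ x₂ k₂ hp₀.le hp₁.le φ₁ φ₂ h₁.isUncorrelatedProbe h₂.isUncorrelatedProbe,
    fun hkap hweak S R p hp₀ hp₁ => (hseparated hkap hweak S R p hp₀ hp₁).imp
      fun L hL x₁ k₁ x₂ k₂ φ₁ φ₂ h₁ h₂ =>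
        hL x₁ k₁ x₂ k₂ φ₁ φ₂ h₁.isUncorrelatedProbe h₂.isUncorrelatedProbe⟩
  have ha : 0 < a := by simpa using hD.diag_pos (i := 0)
  have hdet : 0 < a * d - b * b := by simpa [Matrix.det_fin_two_of] using hD.det_pos
  rw [twoModeGaussian_eq_shearedProduct ha hdet, twoModeGaussian_neg_eq_shearedProduct ha hdet,
    ← abs_of_pos ha, ← abs_div, abs_of_pos ha, ← div_pos_iff_of_pos_right ha, mul_div_assoc]
  exact hsheared (b / a) _ _ ψ (isGaussianWave_centeredGaussian ha).isSystemState
    (isGaussianWave_centeredGaussian (div_pos hdet ha)).isSystemState hψ
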